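/- **Conventions.** Write dual objects as $\mathring x=x_r+\epsilon x_c$ with $\epsilon^2=0$ (real part $x_r$, dual part $x_c$; derivatives, limits and $\operatorname{red},\operatorname{aug},\operatorname{sgn}$ act on both parts). Quaternion multiplication $\circ$, conjugation $*$ and the cross product are extended to dual quaternions and dual vectors by bilinearity; $\operatorname{aug}(x)$ is the quaternion with scalar part $0$ and vector part $x\in\mathbb R^3$, and $\operatorname{red}$ is the vector part of a quaternion. Put $\operatorname{crs}(\mathring x,\mathring y)=x_r^\top y_c+x_c^\top y_r$, $\operatorname{exch}(\mathring x)=x_c+\epsilon x_r$, and $$\operatorname{func}(\mathring x,\mathring y,\mathring z)=(\|y_r\times y_c+z_c\|_2+1)\operatorname{sgn}(x_c)+\epsilon(\|y_r\|_2^2+\|z_r\|_2+1)\operatorname{sgn}(x_r),$$ with the componentwise sign. **System.** Let $0=h_0<h_1<\dots<h_s=T<\infty$, $s\ge1$. For each iteration $k=0,1,2,\dots$ let $\mathring Q_k=Q_k+\epsilon\tfrac12Q_k\circ\operatorname{aug}(P_k)$, with $Q_k(t)$ a unit quaternion and $P_k(t)\in\mathbb R^3$, and $\mathring\omega_k=\omega_k+\epsilon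 v_k$ satisfy on $[0,T]$ $$\dot{\mathring Q}_k=\tfrac12\mathring Q_k\circ\operatorname{aug}(\mathring\omega_k),\qquad \mathring M\dot{\mathring\omega}_k=-\mathring\omega_k^\times\mathring M\mathring\omega_k+\mathring f_k+\mathring d_k,\qquad \mathring M\mathring x=m\,x_c+\epsilon Jx_r,$$ where $m>0$ and $J\in\mathbb R^{3\times3}$ is symmetric positive definite. Let the desired motion $\mathring Q_d=Q_d+\epsilon\frac12Q_d\circ\operatorname{aug}(P_d)$, $Q_d(t)$ a unit quaternion, satisfy $\dot{\mathring Q}_d=\frac12\mathring Q_d\circ\operatorname{aug}(\mathring\omega_d)$, with $\mathring\omega_d$ differentiable and $\mathring\omega_d,\dot{\mathring\omega}_d$ bounded on $[0,T]$. Put $\delta\mathring Q_k=\mathring Q_d^*\circ\mathring Q_k$, $\operatorname{tr}(\mathring x)=\operatorname{red}(\delta\mathring Q_k^*\circ\operatorname{aug}(\mathring x)\circ\delta\mathring Q_k)$, $\delta\mathring\omega_k=\mathring\omega_k-\operatorname{tr}(\mathring\omega_d)$, and, with $\delta Q_k=Q_d^*\circ Q_k$ the real part of $\delta\mathring Q_k$,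 $\delta P_k=P_k-\operatorname{red}(\delta Q_k^*\circ\operatorname{aug}(P_d)\circ\delta Q_k)$ and $\delta q_k=\operatorname{red}(\delta Q_k)$. **Assumptions.** (i) For every $k$: $\delta\mathring Q_k(0)=\varsigma_k\mathbf 1+\epsilon\mathbf 0$ with a sign $\varsigma_k\in\{1,-1\}$, and $\delta\mathring\omega_k(0)=0$. (ii) There are (unknown) $\beta_m,\beta_J<\infty$ and functions $\beta_d,\beta_s$ bounded on $[0,T]$ with $m\le\beta_m$, $\|J\|\le\beta_J$ and, writing $\mathring d_k=d_k+\epsilon s_k$, $\|d_k(t)\|\le\beta_d(t)$ and $\|s_k(t)\|\le\beta_s(t)$ for all $k$ and all $t\in[0,T]$. **Learning control.** Let $k_p,k_d,k_c,k_\theta>0$. For $t\in[0,T]$ put $p(t)=\min\{j\in\{1,\dots,s\}:h_j\ge t\}$ and $$\operatorname{proj}(x)(t)=\max\Big\{x(t),\ \sup_{\tau\in(h_{p(t)-1},h_{p(t)}]}x(\tau)-k_c\Big\}.$$ Let $$\mathring f_k=-\hat\theta_k\operatorname{func}\big(\delta\mathring\omega_k,\operatorname{tr}(\mathring\omega_d),\operatorname{tr}(\dot{\mathring\omega}_d)\big)-k_d\operatorname{exch}(\delta\mathring\omega_k)-\epsilon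 k_p\operatorname{red}\big((\delta\mathring Q_k)_r\big)-k_p\operatorname{red}\big((\delta\mathring Q_k^*)_r\circ(\delta\mathring Q_k)_c\big)$$ for $k\ge0$, with $\hat\theta_0=0$ and $$\hat\theta_k-\operatorname{proj}(\hat\theta_{k-1})=k_\theta\operatorname{crs}\big(\delta\mathring\omega_k,\operatorname{func}(\delta\mathring\omega_k,\operatorname{tr}(\mathring\omega_d),\operatorname{tr}(\dot{\mathring\omega}_d))\big),\qquad k\ge1.$$ As the control law is discontinuous, each $\mathring\omega_k$ is an absolutely continuous function that satisfies its equation at almost every $t\in[0,T]$, and the sign of a vanishing component in $\mathring f_k(t)$ may take any value in $[-1,1]$ (which includes the convention $\operatorname{sgn}(0)=0$). **Theorem 1.** For all such motions the following holds. (a1) Perfect tracking: for every $t\in[0,T]$, as $k\to\infty$, $\varsigma_k\,\delta\mathring Q_k(t)\to\mathbf 1+\epsilon\mathbf 0$ and $\varsigma_k\mathring Q_k(t)\to\mathring Q_d(t)$, and $\|\delta P_k(t)\|_2\to0$, $\|\delta q_k(t)\|_2\to0$. In particular, if $\varsigma_k=1$ for all $k$, then $\delta\mathring Q_k(t)\to\mathbf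 1+\epsilon\mathbf 0$ and $\mathring Q_k(t)\to\mathring Q_d(t)$. (a2) Boundedness: the real and dual parts of $\mathring f_k(t)$, $\delta\mathring Q_k(t)$, $\delta\mathring\omega_k(t)$ and the estimates $\hat\theta_k(t)$ are bounded uniformly in $k\in\{0,1,2,\dots\}$ and $t\in[0,T]$. -/

import Mathlib

open Set Filter Topology MeasureTheory
open scoped Quaternion

noncomputable section

namespace DualILC

/-- Euclidean three-space. -/
abbrev Vec3 := EuclideanSpace ℝ (Fin 3)

/-- Dual three-vectors `x_r + ε x_c`; `TrivSqZeroExt.fst` is the real part and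
`TrivSqZeroExt.snd` is the dual part. -/
abbrev DualVec3 := DualNumber Vec3

/-- Dual quaternions `Q_r + ε Q_c`, with the multiplication of the dual numbers over `ℍ`:
`(a + ε b) * (c + ε d) = a c + ε (a d + b c)`. -/
abbrev DualQuat := DualNumber ℍ[ℝ]

/-- The dual object `a + ε b`. -/
def dual {V : Type*} [AddMonoid V] (a b : V) : DualNumber V :=
  TrivSqZeroExt.inl a + TrivSqZeroExt.inr b

/-- `f` has derivative `f'` at `t` within `s`, for the real part and for the dual part. -/
def HasDualDerivWithinAt {V : Type*} [NormedAddCommGroup V] [NormedSpace ℝ V]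
    (f : ℝ → DualNumber V) (f' : DualNumber V) (s : Set ℝ) (t : ℝ) : Prop :=
  HasDerivWithinAt (fun τ => (f τ).fst) f'.fst s t ∧
    HasDerivWithinAt (fun τ => (f τ).snd) f'.snd s t

/-- Both parts of `f` are absolutely continuous on `[0, T]`. -/
def DualAbsolutelyContinuous {V : Type*} [NormedAddCommGroup V]
    (f : ℝ → DualNumber V) (T : ℝ) : Prop :=
  AbsolutelyContinuousOnInterval (fun τ => (f τ).fst) 0 T ∧
    AbsolutelyContinuousOnInterval (fun τ => (f τ).snd) 0 T

/-! ### Vector and quaternion operators -/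

/-- The cross product `x^× y`. -/
def cross (x y : Vec3) : Vec3 := WithLp.toLp 2 (crossProduct x.ofLp y.ofLp)

/-- The pure quaternion with vector part `x`. -/
def aug (x : Vec3) : ℍ[ℝ] := ⟨0, x 0, x 1, x 2⟩

/-- The vector part of a quaternion. -/
def red (q : ℍ[ℝ]) : Vec3 := !₂[q.imI, q.imJ, q.imK]

/-- The componentwise sign, with `sgn 0 = 0`. -/
def sgn (x : Vec3) : Vec3 := WithLp.toLp 2 (fun i => Real.sign (x i))

/-- `u` is a value of the componentwise set-valued sign at `x`: the component `u i` is the sign of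
`x i` where `x i ≠ 0`, and lies in `[-1, 1]` where `x i = 0`. -/
def IsSgnValue (u x : Vec3) : Prop :=
  ∀ i, (0 < x i → u i = 1) ∧ (x i < 0 → u i = -1) ∧ |u i| ≤ 1

/-! ### Their dual versions -/

def dualCross (x y : DualVec3) : DualVec3 :=
  dual (cross x.fst y.fst) (cross x.fst y.snd + cross x.snd y.fst)

def dualAug (x : DualVec3) : DualQuat := dual (aug x.fst) (aug x.snd)

def dualRed (q : DualQuat) : DualVec3 := dual (red q.fst) (red q.snd)

def dualConj (q : DualQuat) : DualQuat := dual (star q.fst) (star q.snd)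

def dualSgn (x : DualVec3) : DualVec3 := dual (sgn x.fst) (sgn x.snd)

def IsDualSgnValue (u x : DualVec3) : Prop :=
  IsSgnValue u.fst x.fst ∧ IsSgnValue u.snd x.snd

/-- `crs (x, y) = x_rᵀ y_c + x_cᵀ y_r`. -/
def crs (x y : DualVec3) : ℝ := inner ℝ x.fst y.snd + inner ℝ x.snd y.fst

/-- `exch (x_r + ε x_c) = x_c + ε x_r`. -/
def exch (x : DualVec3) : DualVec3 := dual x.snd x.fst

/-- The single-valued sign is one of the values of the set-valued sign. -/
theorem isDualSgnValue_dualSgn (x : DualVec3) : IsDualSgnValue (dualSgn x) x := by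
  have key : ∀ y : Vec3, IsSgnValue (sgn y) y := by
    intro y i
    refine ⟨fun hy => ?_, fun hy => ?_, ?_⟩
    · simp [sgn, Real.sign_of_pos hy]
    · simp [sgn, Real.sign_of_neg hy]
    · rcases Real.sign_apply_eq (y i) with hy | hy | hy <;> simp [sgn, hy]
  simpa [IsDualSgnValue, dualSgn, dual] using ⟨key x.fst, key x.snd⟩

/-! ### Rigid-body motion -/

/-- The dual quaternion `Q + ε ½ Q ∘ aug P` of the attitude `Q` and the position `P`. -/
def pose (Q : ℍ[ℝ]) (P : Vec3) : DualQuat := dual Q ((1 / 2 : ℝ) • (Q * aug P))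

/-- The dual inertia operator `M = m I₃ d/dε + ε J`. -/
def inertia (m : ℝ) (J : Matrix (Fin 3) (Fin 3) ℝ) (x : DualVec3) : DualVec3 :=
  dual (m • x.snd) (Matrix.toEuclideanCLM (𝕜 := ℝ) J x.fst)

/-- The kinematics `Q̊' = ½ Q̊ ∘ aug ω̊` on `[0, T]`. -/
def Kinematics (T : ℝ) (X : ℝ → DualQuat) (ω : ℝ → DualVec3) : Prop :=
  ∀ t ∈ Icc 0 T, HasDualDerivWithinAt X ((1 / 2 : ℝ) • (X t * dualAug (ω t))) (Icc 0 T) t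

/-- The dynamics `M ω̊' = -ω̊^× M ω̊ + f̊ + d̊` on `[0, T]`, in the Carathéodory sense: `ω̊` is
absolutely continuous and the equation holds at almost every time. -/
def Dynamics (T m : ℝ) (J : Matrix (Fin 3) (Fin 3) ℝ) (ω f d : ℝ → DualVec3) : Prop :=
  DualAbsolutelyContinuous ω T ∧
    ∀ᵐ t ∂(volume.restrict (Icc 0 T)), ∃ w : DualVec3,
      HasDualDerivWithinAt ω w (Icc 0 T) t ∧
        inertia m J w = -dualCross (ω t) (inertia m J (ω t)) + f t + d t

/-! ### Tracking errors -/

/-- `δQ̊ = Q̊_d^* ∘ Q̊`. -/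
def poseError (Xd X : DualQuat) : DualQuat := dualConj Xd * X

/-- `δP = P - red (δQ^* ∘ aug P_d ∘ δQ)` with `δQ = Q_d^* ∘ Q`. -/
def positionError (Qd : ℍ[ℝ]) (Pd : Vec3) (Q : ℍ[ℝ]) (P : Vec3) : Vec3 :=
  P - red (star (star Qd * Q) * aug Pd * (star Qd * Q))

/-- `tr (x) = red (δQ̊^* ∘ aug x ∘ δQ̊)`. -/
def tr (δQ : DualQuat) (x : DualVec3) : DualVec3 := dualRed (dualConj δQ * dualAug x * δQ)

/-- `δω̊ = ω̊ - tr ω̊_d`. -/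
def velocityError (δQ : DualQuat) (ωd ω : DualVec3) : DualVec3 := ω - tr δQ ωd

/-! ### Controller and learning law -/

/-- The function `func (x, y, z)`, as a function of a value `u` of the sign at `x`. -/
def funcOfSgn (u y z : DualVec3) : DualVec3 :=
  dual ((‖cross y.fst y.snd + z.snd‖ + 1) • u.snd)
    ((‖y.fst‖ ^ 2 + ‖z.fst‖ + 1) • u.fst)

def func (x y z : DualVec3) : DualVec3 := funcOfSgn (dualSgn x) y z

/-- The control law; `u` is the value that is taken for the sign of `δω̊`. -/
def control (kp kd θhat : ℝ) (δQ : DualQuat) (δω u ωd ωd' : DualVec3) : DualVec3 :=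
  -(θhat • funcOfSgn u (tr δQ ωd) (tr δQ ωd')) - kd • exch δω
    - kp • dual 0 (red δQ.fst)
    - kp • dual (red ((dualConj δQ).fst * δQ.snd)) 0

/-- `p(t) = min {j ∈ {1, …, s} : h_j ≥ t}`. -/
def segIndex (s : ℕ) (h : ℕ → ℝ) (t : ℝ) : ℕ := sInf {j : ℕ | 1 ≤ j ∧ j ≤ s ∧ t ≤ h j}

/-- The segment-based dynamic projection of width `kc`. -/
def proj (s : ℕ) (h : ℕ → ℝ) (kc : ℝ) (x : ℝ → ℝ) (t : ℝ) : ℝ :=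
  if sSup (x '' Ioc (h (segIndex s h t - 1)) (h (segIndex s h t))) - kc < x t then x t
  else sSup (x '' Ioc (h (segIndex s h t - 1)) (h (segIndex s h t))) - kc

/-- The increment `kθ crs (δω̊, func (δω̊, tr ω̊_d, tr ω̊_d'))` of the learning law. -/
def learningIncrement (kθ : ℝ) (δQ : DualQuat) (δω ωd ωd' : DualVec3) : ℝ :=
  kθ * crs δω (func δω (tr δQ ωd) (tr δQ ωd'))

end DualILC

end

open DualILC

/-!
The energy of the tracking error is nonincreasing as long as the estimate dominates the level `θ`
of the uncertainties, because the robust term of the input is then at least as strong as the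
disturbance and the unknown part of the rigid body dynamics. On the other hand, every iteration
raises the estimate at least in proportion to its error. On each segment of the partition one of
two things happens. Either the estimate stays below `θ + kc` for all iterations and all times, and
then the errors are summable over the iterations. Or it reaches `θ + kc` once, and then the
projection lifts it above `θ` on the whole segment for all later iterations, so that the energy
bounds the errors on the segment by those made before it. By induction over the segments, the
errors are summable over the iterations, uniformly in time. As the distance of the pose error from
`±1` is at most the integral of the velocity error, this yields perfect tracking.
-/

namespace DualILC

section Parts

@[simp] theorem fst_dual {V : Type*} [AddMonoid V] (a b : V) : (dual a b).fst = a := by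
  simp [dual]

@[simp] theorem snd_dual {V : Type*} [AddMonoid V] (a b : V) : (dual a b).snd = b := by
  simp [dual]

variable (q : DualQuat) (x y : DualVec3)

@[simp] theorem fst_dualConj : (dualConj q).fst = star q.fst := fst_dual _ _
@[simp] theorem snd_dualConj : (dualConj q).snd = star q.snd := snd_dual _ _
@[simp] theorem fst_dualAug : (dualAug x).fst = aug x.fst := fst_dual _ _
@[simp] theorem snd_dualAug : (dualAug x).snd = aug x.snd := snd_dual _ _
@[simp] theorem fst_dualRed : (dualRed q).fst = red q.fst := fst_dual _ _
@[simp] theorem snd_dualRed : (dualRed q).snd = red q.snd := snd_dual _ _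

@[simp] theorem fst_dualCross : (dualCross x y).fst = cross x.fst y.fst := fst_dual _ _
@[simp] theorem snd_dualCross :
    (dualCross x y).snd = cross x.fst y.snd + cross x.snd y.fst := snd_dual _ _

@[simp] theorem fst_inertia (m : ℝ) (J : Matrix (Fin 3) (Fin 3) ℝ) :
    (inertia m J x).fst = m • x.snd := fst_dual _ _
@[simp] theorem snd_inertia (m : ℝ) (J : Matrix (Fin 3) (Fin 3) ℝ) :
    (inertia m J x).snd = Matrix.toEuclideanCLM (𝕜 := ℝ) J x.fst := snd_dual _ _

end Parts

/-! ### Pure quaternions -/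

@[simp] theorem re_aug (x : Vec3) : (aug x).re = 0 := rfl
@[simp] theorem imI_aug (x : Vec3) : (aug x).imI = x 0 := rfl
@[simp] theorem imJ_aug (x : Vec3) : (aug x).imJ = x 1 := rfl
@[simp] theorem imK_aug (x : Vec3) : (aug x).imK = x 2 := rfl

@[simp] theorem red_apply_zero (q : ℍ[ℝ]) : red q 0 = q.imI := rfl
@[simp] theorem red_apply_one (q : ℍ[ℝ]) : red q 1 = q.imJ := rfl
@[simp] theorem red_apply_two (q : ℍ[ℝ]) : red q 2 = q.imK := rfl

/-- `red` as a continuous linear map, for its linearity, continuity and differentiability. -/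
noncomputable def redCLM : ℍ[ℝ] →L[ℝ] Vec3 :=
  LinearMap.toContinuousLinearMap
    { toFun := red
      map_add' := fun a b => by ext i; fin_cases i <;> simp
      map_smul' := fun c a => by ext i; fin_cases i <;> simp }

/-- `aug` as a continuous linear map, for its linearity, continuity and differentiability. -/
noncomputable def augCLM : Vec3 →L[ℝ] ℍ[ℝ] :=
  LinearMap.toContinuousLinearMap
    { toFun := aug
      map_add' := fun x y => by ext <;> simp
      map_smul' := fun c x => by ext <;> simp }

theorem aug_add (x y : Vec3) : aug (x + y) = aug x + aug y := map_add augCLM x y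

theorem aug_sub (x y : Vec3) : aug (x - y) = aug x - aug y := map_sub augCLM x y

@[simp] theorem red_aug (x : Vec3) : red (aug x) = x := by
  ext i; fin_cases i <;> rfl

theorem aug_red_of_star_eq_neg {q : ℍ[ℝ]} (hq : star q = -q) : aug (red q) = q := by
  have hre := congrArg QuaternionAlgebra.re hq
  simp only [Quaternion.re_star, Quaternion.re_neg] at hre
  ext <;> simp only [re_aug, imI_aug, imJ_aug, imK_aug, red_apply_zero, red_apply_one,
    red_apply_two]
  linarith

@[simp] theorem star_aug (x : Vec3) : star (aug x) = -aug x := by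
  ext <;> simp

theorem inner_quaternion_eq (a b : ℍ[ℝ]) :
    inner ℝ a b = a.re * b.re + a.imI * b.imI + a.imJ * b.imJ + a.imK * b.imK := by
  rw [Quaternion.inner_def]; simp

theorem inner_vec3_eq (x y : Vec3) : inner ℝ x y = x 0 * y 0 + x 1 * y 1 + x 2 * y 2 := by
  simp only [PiLp.inner_apply, RCLike.inner_apply, conj_trivial, Fin.sum_univ_three]
  ring

theorem inner_aug_right (q : ℍ[ℝ]) (x : Vec3) : inner ℝ q (aug x) = inner ℝ (red q) x := by
  rw [inner_quaternion_eq, inner_vec3_eq]; simp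

@[simp] theorem norm_aug (x : Vec3) : ‖aug x‖ = ‖x‖ := by
  rw [← sq_eq_sq₀ (norm_nonneg _) (norm_nonneg _), ← real_inner_self_eq_norm_sq,
    ← real_inner_self_eq_norm_sq, inner_aug_right, red_aug]

theorem norm_red_le (q : ℍ[ℝ]) : ‖red q‖ ≤ ‖q‖ := by
  refine le_of_sq_le_sq ?_ (norm_nonneg _)
  rw [← real_inner_self_eq_norm_sq, ← real_inner_self_eq_norm_sq, inner_quaternion_eq,
    inner_vec3_eq]
  simp only [red_apply_zero, red_apply_one, red_apply_two]
  nlinarith only [mul_self_nonneg q.re]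

@[simp] theorem cross_apply_zero (x y : Vec3) : cross x y 0 = x 1 * y 2 - x 2 * y 1 := by
  simp [cross, crossProduct]
@[simp] theorem cross_apply_one (x y : Vec3) : cross x y 1 = x 2 * y 0 - x 0 * y 2 := by
  simp [cross, crossProduct]
@[simp] theorem cross_apply_two (x y : Vec3) : cross x y 2 = x 0 * y 1 - x 1 * y 0 := by
  simp [cross, crossProduct]

theorem aug_mul_aug_sub (x y : Vec3) :
    aug x * aug y - aug y * aug x = (2 : ℝ) • aug (cross x y) := by
  ext <;> simp <;> ring

theorem norm_cross_le (x y : Vec3) : ‖cross x y‖ ≤ ‖x‖ * ‖y‖ := by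
  have h := norm_sub_le (aug x * aug y) (aug y * aug x)
  rw [aug_mul_aug_sub, norm_smul] at h
  simp only [norm_mul, norm_aug, Real.norm_ofNat] at h
  linarith [mul_comm ‖x‖ ‖y‖]

theorem norm_eq_one_of_mul_star_self {q : ℍ[ℝ]} (hq : q * star q = 1) : ‖q‖ = 1 := by
  have h := congrArg norm hq
  rw [norm_mul, Quaternion.norm_star, norm_one] at h
  nlinarith [norm_nonneg q]

/-! ### The algebra of dual quaternions -/

theorem dualAug_sub (x y : DualVec3) : dualAug (x - y) = dualAug x - dualAug y := by
  ext1 <;> simp [aug_sub]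

@[simp] theorem dualRed_dualAug (x : DualVec3) : dualRed (dualAug x) = x := by
  ext1 <;> simp

theorem dualAug_dualRed_of_dualConj_eq_neg {q : DualQuat} (hq : dualConj q = -q) :
    dualAug (dualRed q) = q := by
  have hfst := congrArg TrivSqZeroExt.fst hq
  have hsnd := congrArg TrivSqZeroExt.snd hq
  ext1
  · simpa using aug_red_of_star_eq_neg (by simpa using hfst)
  · simpa using aug_red_of_star_eq_neg (by simpa using hsnd)

theorem dualConj_mul (p q : DualQuat) : dualConj (p * q) = dualConj q * dualConj p := by
  ext1 <;> simp [add_comm]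

@[simp] theorem dualConj_dualConj (q : DualQuat) : dualConj (dualConj q) = q := by
  ext1 <;> simp

theorem dualConj_smul (c : ℝ) (q : DualQuat) : dualConj (c • q) = c • dualConj q := by
  ext1 <;> simp [Quaternion.star_smul]

@[simp] theorem dualConj_dualAug (x : DualVec3) : dualConj (dualAug x) = -dualAug x := by
  ext1 <;> simp

theorem dualAug_tr (D : DualQuat) (x : DualVec3) :
    dualAug (tr D x) = dualConj D * dualAug x * D :=
  dualAug_dualRed_of_dualConj_eq_neg <| by simp [dualConj_mul, mul_assoc]

theorem dualAug_dualCross (x y : DualVec3) :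
    dualAug (dualCross x y) = (1 / 2 : ℝ) • (dualAug x * dualAug y - dualAug y * dualAug x) := by
  have key : ∀ a b : Vec3, aug (cross a b) = (1 / 2 : ℝ) • (aug a * aug b - aug b * aug a) :=
    fun a b => by rw [aug_mul_aug_sub, smul_smul]; norm_num
  ext1
  · simp [key]
  · simp only [snd_dualAug, snd_dualCross, aug_add, key, TrivSqZeroExt.snd_smul,
      TrivSqZeroExt.snd_sub, DualNumber.snd_mul, fst_dualAug, ← smul_add]
    congr 1
    abel

/-! ### Unit dual quaternions -/

/-- Unit dual quaternions, on which `dualConj` is a two-sided inverse. -/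
def IsUnitDual (q : DualQuat) : Prop :=
  dualConj q * q = 1 ∧ q * dualConj q = 1

theorem isUnitDual_pose {Q : ℍ[ℝ]} (hQ : Q * star Q = 1) (P : Vec3) : IsUnitDual (pose Q P) := by
  have hQ' : star Q * Q = 1 := mul_eq_one_comm.1 hQ
  constructor <;> ext1 <;>
    simp [pose, hQ, hQ', mul_assoc, Quaternion.star_smul, ← mul_assoc (star Q) Q]

namespace IsUnitDual

variable {p q : DualQuat}

theorem poseError (hp : IsUnitDual p) (hq : IsUnitDual q) : IsUnitDual (poseError p q) := by
  constructor <;> rw [DualILC.poseError, dualConj_mul, dualConj_dualConj]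
  · calc dualConj q * p * (dualConj p * q) = dualConj q * (p * dualConj p) * q := by
          simp only [mul_assoc]
      _ = 1 := by rw [hp.2, mul_one, hq.1]
  · calc dualConj p * q * (dualConj q * p) = dualConj p * (q * dualConj q) * p := by
          simp only [mul_assoc]
      _ = 1 := by rw [hq.2, mul_one, hp.1]

theorem fst_mul_star_fst (hq : IsUnitDual q) : q.fst * star q.fst = 1 := by
  simpa using congrArg TrivSqZeroExt.fst hq.2

theorem norm_fst (hq : IsUnitDual q) : ‖q.fst‖ = 1 :=
  norm_eq_one_of_mul_star_self hq.fst_mul_star_fst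

theorem norm_fst_tr (hq : IsUnitDual q) (x : DualVec3) : ‖(tr q x).fst‖ = ‖x.fst‖ := by
  have h := congrArg (fun p => ‖TrivSqZeroExt.fst p‖) (dualAug_tr q x)
  simpa [hq.norm_fst] using h

theorem norm_snd_tr_le (hq : IsUnitDual q) (x : DualVec3) :
    ‖(tr q x).snd‖ ≤ ‖x.snd‖ + 2 * ‖q.snd‖ * ‖x.fst‖ := by
  have hsnd : aug (tr q x).snd = star q.fst * aug x.fst * q.snd +
      (star q.fst * aug x.snd * q.fst + star q.snd * aug x.fst * q.fst) := by
    simpa using congrArg TrivSqZeroExt.snd (dualAug_tr q x)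
  have hbound := norm_add₃_le (a := star q.fst * aug x.fst * q.snd)
    (b := star q.fst * aug x.snd * q.fst) (c := star q.snd * aug x.fst * q.fst)
  rw [← norm_aug, hsnd, ← add_assoc]
  simp only [norm_mul, Quaternion.norm_star, hq.norm_fst, norm_aug, one_mul, mul_one] at hbound
  linarith [mul_comm ‖q.snd‖ ‖x.fst‖]

end IsUnitDual

/-! ### Derivatives of dual functions -/

instance : StarModule ℝ ℍ[ℝ] := ⟨Quaternion.star_smul⟩

instance : IsScalarTower ℝ DualQuat DualQuat :=
  ⟨fun c p q => by ext1 <;> simp [smul_add]⟩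

theorem continuous_dualAug : Continuous dualAug :=
  (TrivSqZeroExt.continuous_inl.comp (augCLM.continuous.comp TrivSqZeroExt.continuous_fst)).add
    (TrivSqZeroExt.continuous_inr.comp (augCLM.continuous.comp TrivSqZeroExt.continuous_snd))

theorem continuousOn_dualNumber {V : Type*} [NormedAddCommGroup V] {f : ℝ → DualNumber V}
    {s : Set ℝ} (hfst : ContinuousOn (fun t => (f t).fst) s)
    (hsnd : ContinuousOn (fun t => (f t).snd) s) : ContinuousOn f s := by
  refine ((TrivSqZeroExt.continuous_inl.comp_continuousOn hfst).add
    (TrivSqZeroExt.continuous_inr.comp_continuousOn hsnd)).congr fun t _ => ?_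
  exact (TrivSqZeroExt.inl_fst_add_inr_snd_eq (f t)).symm

theorem exists_norm_le_of_continuousOn {V : Type*} [NormedAddCommGroup V]
    {f : ℝ → DualNumber V} {s : Set ℝ} (hs : IsCompact s) (hf : ContinuousOn f s) :
    ∃ C, ∀ t ∈ s, ‖(f t).fst‖ ≤ C ∧ ‖(f t).snd‖ ≤ C := by
  obtain ⟨A, hA⟩ := hs.exists_bound_of_continuousOn
    (TrivSqZeroExt.continuous_fst.comp_continuousOn hf)
  obtain ⟨B, hB⟩ := hs.exists_bound_of_continuousOn
    (TrivSqZeroExt.continuous_snd.comp_continuousOn hf)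
  exact ⟨max A B, fun t ht => ⟨le_max_of_le_left (hA t ht), le_max_of_le_right (hB t ht)⟩⟩

namespace HasDualDerivWithinAt

variable {s : Set ℝ} {t : ℝ}

theorem congr_deriv {V : Type*} [NormedAddCommGroup V] [NormedSpace ℝ V]
    {f : ℝ → DualNumber V} {f' g' : DualNumber V}
    (hf : HasDualDerivWithinAt f f' s t) (h : f' = g') : HasDualDerivWithinAt f g' s t :=
  h ▸ hf

theorem sub {V : Type*} [NormedAddCommGroup V] [NormedSpace ℝ V]
    {f g : ℝ → DualNumber V} {f' g' : DualNumber V}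
    (hf : HasDualDerivWithinAt f f' s t) (hg : HasDualDerivWithinAt g g' s t) :
    HasDualDerivWithinAt (fun τ => f τ - g τ) (f' - g') s t :=
  ⟨hf.1.sub hg.1, hf.2.sub hg.2⟩

theorem mul {A : Type*} [NormedRing A] [NormedAlgebra ℝ A] {f g : ℝ → DualNumber A}
    {f' g' : DualNumber A}
    (hf : HasDualDerivWithinAt f f' s t) (hg : HasDualDerivWithinAt g g' s t) :
    HasDualDerivWithinAt (fun τ => f τ * g τ) (f' * g t + f t * g') s t := by
  constructor
  · simp only [TrivSqZeroExt.fst_mul, TrivSqZeroExt.fst_add]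
    exact hf.1.mul hg.1
  · simp only [DualNumber.snd_mul, TrivSqZeroExt.snd_add]
    exact ((hf.1.mul hg.2).add (hf.2.mul hg.1)).congr_deriv (by abel)

theorem dualConj {f : ℝ → DualQuat} {f' : DualQuat} (hf : HasDualDerivWithinAt f f' s t) :
    HasDualDerivWithinAt (fun τ => dualConj (f τ)) (dualConj f') s t := by
  constructor
  · simpa using hf.1.star
  · simpa using hf.2.star

theorem dualAug {x : ℝ → DualVec3} {x' : DualVec3} (hx : HasDualDerivWithinAt x x' s t) :
    HasDualDerivWithinAt (fun τ => dualAug (x τ)) (dualAug x') s t := by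
  simp only [HasDualDerivWithinAt, fst_dualAug, snd_dualAug]
  exact ⟨augCLM.hasFDerivAt.comp_hasDerivWithinAt t hx.1,
    augCLM.hasFDerivAt.comp_hasDerivWithinAt t hx.2⟩

theorem dualRed {f : ℝ → DualQuat} {f' : DualQuat} (hf : HasDualDerivWithinAt f f' s t) :
    HasDualDerivWithinAt (fun τ => dualRed (f τ)) (dualRed f') s t := by
  simp only [HasDualDerivWithinAt, fst_dualRed, snd_dualRed]
  exact ⟨redCLM.hasFDerivAt.comp_hasDerivWithinAt t hf.1,
    redCLM.hasFDerivAt.comp_hasDerivWithinAt t hf.2⟩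

end HasDualDerivWithinAt

theorem continuousOn_of_hasDualDerivWithinAt {V : Type*} [NormedAddCommGroup V]
    [NormedSpace ℝ V] {f f' : ℝ → DualNumber V} {s : Set ℝ}
    (hf : ∀ t ∈ s, HasDualDerivWithinAt f (f' t) s t) : ContinuousOn f s :=
  continuousOn_dualNumber (fun t ht => (hf t ht).1.continuousWithinAt)
    (fun t ht => (hf t ht).2.continuousWithinAt)

/-! ### Absolutely continuous functions -/

section AbsoluteContinuity

variable {E F : Type*} [NormedAddCommGroup E] [NormedAddCommGroup F] {a b : ℝ}

theorem absolutelyContinuousOnInterval_prodMk {f : ℝ → E} {g : ℝ → F}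
    (hf : AbsolutelyContinuousOnInterval f a b) (hg : AbsolutelyContinuousOnInterval g a b) :
    AbsolutelyContinuousOnInterval (fun t => (f t, g t)) a b := by
  unfold AbsolutelyContinuousOnInterval at hf hg ⊢
  refine squeeze_zero (fun _ => Finset.sum_nonneg fun _ _ => dist_nonneg) (fun I => ?_)
    (by simpa using hf.add hg)
  rw [← Finset.sum_add_distrib]
  exact Finset.sum_le_sum fun i _ =>
    Prod.dist_eq.trans_le (max_le_add_of_nonneg dist_nonneg dist_nonneg)

theorem absolutelyContinuousOnInterval_comp_of_lipschitzOnWith {K : NNReal} {s : Set E}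
    {Φ : E → F} {f : ℝ → E} (hΦ : LipschitzOnWith K Φ s)
    (hf : AbsolutelyContinuousOnInterval f a b) (hs : MapsTo f (uIcc a b) s) :
    AbsolutelyContinuousOnInterval (fun t => Φ (f t)) a b := by
  unfold AbsolutelyContinuousOnInterval at hf ⊢
  refine squeeze_zero' (Eventually.of_forall fun _ => Finset.sum_nonneg fun _ _ => dist_nonneg)
    ?_ (by simpa using hf.const_mul (K : ℝ))
  filter_upwards [mem_inf_of_right (mem_principal_self _)] with I hI
  rw [Finset.mul_sum]
  exact Finset.sum_le_sum fun i hi =>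
    hΦ.dist_le_mul _ (hs (hI.1 i hi).1) _ (hs (hI.1 i hi).2)

variable [NormedSpace ℝ E] [NormedSpace ℝ F]

theorem absolutelyContinuousOnInterval_comp_of_contDiff {Φ : E → F} (hΦ : ContDiff ℝ 1 Φ)
    {f : ℝ → E} (hf : AbsolutelyContinuousOnInterval f a b) :
    AbsolutelyContinuousOnInterval (fun t => Φ (f t)) a b := by
  obtain ⟨K, hK⟩ := (hΦ.locallyLipschitz.locallyLipschitzOn
    (s := f '' uIcc a b)).exists_lipschitzOnWith_of_compact
      (isCompact_uIcc.image_of_continuousOn hf.continuousOn)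
  exact absolutelyContinuousOnInterval_comp_of_lipschitzOnWith hK hf (mapsTo_image f _)

theorem absolutelyContinuousOnInterval_of_hasDerivWithinAt {f f' : ℝ → E} {C : ℝ} (hab : a ≤ b)
    (hf : ∀ t ∈ Icc a b, HasDerivWithinAt f (f' t) (Icc a b) t)
    (hC : ∀ t ∈ Icc a b, ‖f' t‖ ≤ C) : AbsolutelyContinuousOnInterval f a b := by
  apply LipschitzOnWith.absolutelyContinuousOnInterval (K := C.toNNReal)
  rw [uIcc_of_le hab]
  refine (convex_Icc a b).lipschitzOnWith_of_nnnorm_hasDerivWithin_le hf fun t ht => ?_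
  rw [← NNReal.coe_le_coe, coe_nnnorm]
  exact (hC t ht).trans (Real.le_coe_toNNReal C)

end AbsoluteContinuity

namespace DualAbsolutelyContinuous

variable {T : ℝ}

theorem of_hasDualDerivWithinAt {V : Type*} [NormedAddCommGroup V] [NormedSpace ℝ V]
    {f f' : ℝ → DualNumber V} (hT : 0 ≤ T)
    (hf : ∀ t ∈ Icc 0 T, HasDualDerivWithinAt f (f' t) (Icc 0 T) t)
    (hf' : ∃ C, ∀ t ∈ Icc 0 T, ‖(f' t).fst‖ ≤ C ∧ ‖(f' t).snd‖ ≤ C) :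
    DualAbsolutelyContinuous f T := by
  obtain ⟨C, hC⟩ := hf'
  exact ⟨absolutelyContinuousOnInterval_of_hasDerivWithinAt hT (fun t ht => (hf t ht).1)
      fun t ht => (hC t ht).1,
    absolutelyContinuousOnInterval_of_hasDerivWithinAt hT (fun t ht => (hf t ht).2)
      fun t ht => (hC t ht).2⟩

theorem continuousOn {V : Type*} [NormedAddCommGroup V] {f : ℝ → DualNumber V} (hT : 0 ≤ T)
    (hf : DualAbsolutelyContinuous f T) : ContinuousOn f (Icc 0 T) := by
  rw [← uIcc_of_le hT]
  exact continuousOn_dualNumber hf.1.continuousOn hf.2.continuousOn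

theorem sub {V : Type*} [NormedAddCommGroup V] {f g : ℝ → DualNumber V}
    (hf : DualAbsolutelyContinuous f T) (hg : DualAbsolutelyContinuous g T) :
    DualAbsolutelyContinuous (fun t => f t - g t) T :=
  ⟨hf.1.sub hg.1, hf.2.sub hg.2⟩

theorem mul {A : Type*} [NormedRing A] [NormMulClass A] {f g : ℝ → DualNumber A}
    (hf : DualAbsolutelyContinuous f T) (hg : DualAbsolutelyContinuous g T) :
    DualAbsolutelyContinuous (fun t => f t * g t) T := by
  simp only [DualAbsolutelyContinuous, TrivSqZeroExt.fst_mul, DualNumber.snd_mul]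
  exact ⟨hf.1.smul hg.1, (hf.1.smul hg.2).add (hf.2.smul hg.1)⟩

theorem tr {D : ℝ → DualQuat} {x : ℝ → DualVec3} (hD : DualAbsolutelyContinuous D T)
    (hx : DualAbsolutelyContinuous x T) :
    DualAbsolutelyContinuous (fun t => tr (D t) (x t)) T := by
  have hConj : DualAbsolutelyContinuous (fun t => dualConj (D t)) T := by
    simp only [DualAbsolutelyContinuous, fst_dualConj, snd_dualConj]
    have hstar : ContDiff ℝ 1 (star : ℍ[ℝ] → ℍ[ℝ]) := (starL' ℝ : ℍ[ℝ] ≃L[ℝ] ℍ[ℝ]).contDiff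
    exact ⟨absolutelyContinuousOnInterval_comp_of_contDiff hstar hD.1,
      absolutelyContinuousOnInterval_comp_of_contDiff hstar hD.2⟩
  have hAug : DualAbsolutelyContinuous (fun t => dualAug (x t)) T := by
    simp only [DualAbsolutelyContinuous, fst_dualAug, snd_dualAug]
    exact ⟨absolutelyContinuousOnInterval_comp_of_contDiff augCLM.contDiff hx.1,
      absolutelyContinuousOnInterval_comp_of_contDiff augCLM.contDiff hx.2⟩
  have hprod := (hConj.mul hAug).mul hD
  simp only [DualAbsolutelyContinuous, DualILC.tr, fst_dualRed, snd_dualRed]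
  exact ⟨absolutelyContinuousOnInterval_comp_of_contDiff redCLM.contDiff hprod.1,
    absolutelyContinuousOnInterval_comp_of_contDiff redCLM.contDiff hprod.2⟩

end DualAbsolutelyContinuous

theorem le_of_ae_hasDerivAt_nonpos {f : ℝ → ℝ} {a b : ℝ} (hab : a ≤ b)
    (hf : AbsolutelyContinuousOnInterval f a b)
    (hf' : ∀ᵐ t, t ∈ Ioo a b → ∃ f', HasDerivAt f f' t ∧ f' ≤ 0) : f b ≤ f a := by
  have hint : 0 ≤ ∫ t in a..b, -deriv f t := by
    rw [intervalIntegral.integral_of_le hab, integral_Ioc_eq_integral_Ioo]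
    refine setIntegral_nonneg_of_ae_restrict ?_
    filter_upwards [(ae_restrict_iff' measurableSet_Ioo).2 hf'] with t ⟨f', ht, hle⟩
    simpa [ht.deriv] using hle
  rw [intervalIntegral.integral_neg, hf.integral_deriv_eq_sub] at hint
  linarith

/-! ### Error kinematics -/

namespace Kinematics

variable {T t : ℝ} {D : ℝ → DualQuat} {W : ℝ → DualVec3}

theorem poseError {Xd X : ℝ → DualQuat} {ωd ω : ℝ → DualVec3}
    (hd : Kinematics T Xd ωd) (h : Kinematics T X ω)
    (hXd : ∀ t ∈ Icc 0 T, IsUnitDual (Xd t)) (hX : ∀ t ∈ Icc 0 T, IsUnitDual (X t)) :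
    Kinematics T (fun t => poseError (Xd t) (X t))
      (fun t => velocityError (poseError (Xd t) (X t)) (ωd t) (ω t)) := by
  intro t ht
  have hD : DualILC.poseError (Xd t) (X t) * dualConj (DualILC.poseError (Xd t) (X t)) = 1 :=
    ((hXd t ht).poseError (hX t ht)).2
  have hrate : DualILC.poseError (Xd t) (X t) *
      dualAug (velocityError (DualILC.poseError (Xd t) (X t)) (ωd t) (ω t)) =
      DualILC.poseError (Xd t) (X t) * dualAug (ω t) -
        dualAug (ωd t) * DualILC.poseError (Xd t) (X t) := by
    rw [velocityError, dualAug_sub, dualAug_tr, mul_sub, ← mul_assoc, ← mul_assoc, hD, one_mul]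
  refine ((hd t ht).dualConj.mul (h t ht)).congr_deriv ?_
  rw [hrate, dualConj_smul, dualConj_mul, dualConj_dualAug, smul_sub, smul_mul_assoc,
    mul_smul_comm, DualILC.poseError, neg_mul, neg_mul, smul_neg, mul_assoc, mul_assoc]
  abel

theorem hasDualDerivWithinAt_tr (h : Kinematics T D W) {x : ℝ → DualVec3} {x' : DualVec3}
    (ht : t ∈ Icc 0 T) (hx : HasDualDerivWithinAt x x' (Icc 0 T) t) :
    HasDualDerivWithinAt (fun τ => tr (D τ) (x τ))
      (tr (D t) x' - dualCross (W t) (tr (D t) (x t))) (Icc 0 T) t := by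
  refine (((h t ht).dualConj.mul hx.dualAug).mul (h t ht)).dualRed.congr_deriv ?_
  rw [← dualRed_dualAug (_ - _), dualAug_sub, dualAug_dualCross, dualAug_tr, dualAug_tr,
    dualConj_smul, dualConj_mul, dualConj_dualAug]
  congr 1
  simp only [smul_sub, mul_smul_comm, smul_mul_assoc, neg_mul, smul_neg, add_mul, mul_assoc]
  abel

theorem hasDerivWithinAt_fst (h : Kinematics T D W) (ht : t ∈ Icc 0 T) :
    HasDerivWithinAt (fun τ => (D τ).fst) ((1 / 2 : ℝ) • ((D t).fst * aug (W t).fst))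
      (Icc 0 T) t := by
  simpa using (h t ht).1

theorem hasDerivWithinAt_snd (h : Kinematics T D W) (ht : t ∈ Icc 0 T) :
    HasDerivWithinAt (fun τ => (D τ).snd)
      ((1 / 2 : ℝ) • ((D t).fst * aug (W t).snd + (D t).snd * aug (W t).fst)) (Icc 0 T) t := by
  simpa using (h t ht).2

theorem hasDerivWithinAt_snd_mul_star_fst (h : Kinematics T D W) (ht : t ∈ Icc 0 T) :
    HasDerivWithinAt (fun τ => (D τ).snd * star (D τ).fst)
      ((1 / 2 : ℝ) • ((D t).fst * aug (W t).snd * star (D t).fst)) (Icc 0 T) t := by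
  refine ((h.hasDerivWithinAt_snd ht).mul (h.hasDerivWithinAt_fst ht).star).congr_deriv ?_
  simp [mul_assoc, add_mul]

theorem dualAbsolutelyContinuous (hT : 0 ≤ T) (h : Kinematics T D W)
    (hW : ContinuousOn W (Icc 0 T)) : DualAbsolutelyContinuous D T := by
  have hD : ContinuousOn D (Icc 0 T) := continuousOn_of_hasDualDerivWithinAt h
  refine .of_hasDualDerivWithinAt hT h (exists_norm_le_of_continuousOn isCompact_Icc ?_)
  exact (hD.mul (continuous_dualAug.comp_continuousOn hW)).const_smul (1 / 2 : ℝ)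

theorem dualAbsolutelyContinuous_velocityError {ω ωd ωd' : ℝ → DualVec3} (hT : 0 ≤ T)
    (h : Kinematics T D (fun t => velocityError (D t) (ωd t) (ω t)))
    (hω : DualAbsolutelyContinuous ω T)
    (hωd : ∀ t ∈ Icc 0 T, HasDualDerivWithinAt ωd (ωd' t) (Icc 0 T) t)
    (hωd' : ∃ C, ∀ t ∈ Icc 0 T, ‖(ωd' t).fst‖ ≤ C ∧ ‖(ωd' t).snd‖ ≤ C) :
    DualAbsolutelyContinuous (fun t => velocityError (D t) (ωd t) (ω t)) T := by
  have htr : ContinuousOn (fun t => tr (D t) (ωd t)) (Icc 0 T) :=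
    continuousOn_of_hasDualDerivWithinAt fun t ht => h.hasDualDerivWithinAt_tr ht (hωd t ht)
  have hD : DualAbsolutelyContinuous D T :=
    h.dualAbsolutelyContinuous hT ((hω.continuousOn hT).sub htr)
  exact hω.sub (hD.tr (.of_hasDualDerivWithinAt hT hωd hωd'))

end Kinematics

/-! ### Pose error and accumulated velocity error -/

theorem norm_sub_le_integral_of_hasDerivWithinAt {E : Type*} [NormedAddCommGroup E]
    [NormedSpace ℝ E] {f f' : ℝ → E} {B : ℝ → ℝ} {T : ℝ}
    (hf : ∀ t ∈ Icc 0 T, HasDerivWithinAt f (f' t) (Icc 0 T) t)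
    (hB : ContinuousOn B (Icc 0 T)) (hf' : ∀ t ∈ Icc 0 T, ‖f' t‖ ≤ B t) {t : ℝ}
    (ht : t ∈ Icc 0 T) : ‖f t - f 0‖ ≤ ∫ τ in (0)..t, B τ := by
  have hsub : Icc 0 t ⊆ Icc 0 T := Icc_subset_Icc_right ht.2
  have hderiv : ∀ τ ∈ Ioo 0 t, HasDerivAt f (f' τ) τ := fun τ hτ =>
    (hf τ (hsub (Ioo_subset_Icc_self hτ))).hasDerivAt
      (Icc_mem_nhds hτ.1 (hτ.2.trans_le ht.2))
  refine norm_sub_le_integral_of_norm_deriv_le_of_le ht.1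
    (fun τ hτ => ((hf τ (hsub hτ)).continuousWithinAt).mono hsub)
    (fun τ hτ => (hderiv τ hτ).differentiableAt.differentiableWithinAt)
    (Eventually.of_forall fun τ hτ => ?_) ?_
  · rw [(hderiv τ hτ).deriv]
    exact hf' τ (hsub (Ioo_subset_Icc_self hτ))
  · exact (hB.mono (by rwa [uIcc_of_le ht.1])).intervalIntegrable

/-- The size of a dual velocity, which is the error that the learning law suppresses. The dual
numbers over `Vec3` carry no norm in Mathlib, since `Vec3` is not a ring. -/
noncomputable def speed (x : DualVec3) : ℝ := ‖x.fst‖ + ‖x.snd‖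

theorem speed_nonneg (x : DualVec3) : 0 ≤ speed x := by unfold speed; positivity

theorem continuous_speed : Continuous speed :=
  TrivSqZeroExt.continuous_fst.norm.add TrivSqZeroExt.continuous_snd.norm

section PoseBounds

variable {T t : ℝ} {D : ℝ → DualQuat} {W : ℝ → DualVec3}

theorem Kinematics.norm_fst_sub_le_integral_speed (h : Kinematics T D W)
    (hD : ∀ t ∈ Icc 0 T, IsUnitDual (D t)) (hW : ContinuousOn W (Icc 0 T)) (ht : t ∈ Icc 0 T) :
    ‖(D t).fst - (D 0).fst‖ ≤ ∫ τ in (0)..t, speed (W τ) := by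
  refine norm_sub_le_integral_of_hasDerivWithinAt (fun τ hτ => h.hasDerivWithinAt_fst hτ)
    (continuous_speed.comp_continuousOn hW) (fun τ hτ => ?_) ht
  rw [norm_smul, norm_mul, norm_aug, (hD τ hτ).norm_fst, Real.norm_of_nonneg one_half_pos.le,
    Function.comp_apply, speed]
  linarith [norm_nonneg (W τ).fst, norm_nonneg (W τ).snd]

theorem Kinematics.norm_snd_le_integral_speed (h : Kinematics T D W)
    (hD : ∀ t ∈ Icc 0 T, IsUnitDual (D t)) (h0 : (D 0).snd = 0)
    (hW : ContinuousOn W (Icc 0 T)) (ht : t ∈ Icc 0 T) :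
    ‖(D t).snd‖ ≤ ∫ τ in (0)..t, speed (W τ) := by
  have key := norm_sub_le_integral_of_hasDerivWithinAt
    (fun τ hτ => h.hasDerivWithinAt_snd_mul_star_fst hτ) (continuous_speed.comp_continuousOn hW)
    (fun τ hτ => ?_) ht
  · simpa [h0, (hD t ht).norm_fst] using key
  · rw [norm_smul, norm_mul, norm_mul, norm_aug, Quaternion.norm_star, (hD τ hτ).norm_fst,
      Real.norm_of_nonneg one_half_pos.le, Function.comp_apply, speed]
    linarith [norm_nonneg (W τ).fst, norm_nonneg (W τ).snd]

end PoseBounds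

/-! ### The pairing `crs` and the learning increment -/

section Pairing

variable (x y z : DualVec3)

theorem crs_comm : crs x y = crs y x := by
  rw [crs, crs, real_inner_comm x.snd, real_inner_comm x.fst, add_comm]

theorem crs_add_right : crs x (y + z) = crs x y + crs x z := by
  simp only [crs, TrivSqZeroExt.fst_add, TrivSqZeroExt.snd_add, inner_add_right]
  ring

theorem crs_neg_right : crs x (-y) = -crs x y := by
  simp only [crs, TrivSqZeroExt.fst_neg, TrivSqZeroExt.snd_neg, inner_neg_right]
  ring

theorem crs_sub_right : crs x (y - z) = crs x y - crs x z := by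
  rw [sub_eq_add_neg, crs_add_right, crs_neg_right, ← sub_eq_add_neg]

theorem crs_smul_right (c : ℝ) : crs x (c • y) = c * crs x y := by
  simp only [crs, TrivSqZeroExt.fst_smul, TrivSqZeroExt.snd_smul, real_inner_smul_right]
  ring

theorem crs_exch_self : crs x (exch x) = ‖x.fst‖ ^ 2 + ‖x.snd‖ ^ 2 := by
  simp [crs, exch]

theorem crs_dualCross_right : crs x (dualCross y z) = crs (dualCross x y) z := by
  simp only [crs, fst_dualCross, snd_dualCross, inner_vec3_eq, PiLp.add_apply, cross_apply_zero,
    cross_apply_one, cross_apply_two]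
  ring

theorem dualCross_add_self : dualCross x (x + y) = dualCross x y := by
  ext i <;> fin_cases i <;> simp <;> ring

end Pairing

theorem HasDualDerivWithinAt.crs {f g : ℝ → DualVec3} {f' g' : DualVec3} {s : Set ℝ} {t : ℝ}
    (hf : HasDualDerivWithinAt f f' s t) (hg : HasDualDerivWithinAt g g' s t) :
    HasDerivWithinAt (fun τ => crs (f τ) (g τ)) (crs (f t) g' + crs f' (g t)) s t := by
  refine ((hf.1.inner ℝ hg.2).add (hf.2.inner ℝ hg.1)).congr_deriv ?_
  simp only [DualILC.crs]
  ring

namespace IsSgnValue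

variable {u x : Vec3}

theorem inner_eq (h : IsSgnValue u x) : inner ℝ x u = |x 0| + |x 1| + |x 2| := by
  have key : ∀ i, x i * u i = |x i| := by
    intro i
    rcases lt_trichotomy (x i) 0 with hx | hx | hx
    · rw [(h i).2.1 hx, abs_of_neg hx, mul_neg_one]
    · rw [hx, zero_mul, abs_zero]
    · rw [(h i).1 hx, abs_of_pos hx, mul_one]
  rw [inner_vec3_eq, key, key, key]

theorem norm_le (h : IsSgnValue u x) : ‖u‖ ≤ 3 := by
  have key : ∀ i, u i * u i ≤ 1 := fun i => by
    rw [← abs_mul_abs_self]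
    exact mul_le_one₀ (h i).2.2 (abs_nonneg _) (h i).2.2
  refine le_of_sq_le_sq ?_ (by norm_num)
  rw [← real_inner_self_eq_norm_sq, inner_vec3_eq]
  linarith [key 0, key 1, key 2]

theorem norm_le_inner (h : IsSgnValue u x) : ‖x‖ ≤ inner ℝ x u := by
  rw [h.inner_eq]
  refine le_of_sq_le_sq ?_ (by positivity)
  rw [← real_inner_self_eq_norm_sq, inner_vec3_eq]
  nlinarith [abs_mul_abs_self (x 0), abs_mul_abs_self (x 1), abs_mul_abs_self (x 2),
    mul_nonneg (abs_nonneg (x 0)) (abs_nonneg (x 1)),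
    mul_nonneg (abs_nonneg (x 0)) (abs_nonneg (x 2)),
    mul_nonneg (abs_nonneg (x 1)) (abs_nonneg (x 2))]

theorem inner_le (h : IsSgnValue u x) : inner ℝ x u ≤ 3 * ‖x‖ := by
  calc inner ℝ x u ≤ ‖x‖ * ‖u‖ := real_inner_le_norm x u
    _ ≤ ‖x‖ * 3 := by gcongr; exact h.norm_le
    _ = 3 * ‖x‖ := mul_comm _ _

end IsSgnValue

theorem crs_funcOfSgn (x u y z : DualVec3) :
    crs x (funcOfSgn u y z) = (‖y.fst‖ ^ 2 + ‖z.fst‖ + 1) * inner ℝ x.fst u.fst +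
      (‖cross y.fst y.snd + z.snd‖ + 1) * inner ℝ x.snd u.snd := by
  simp [crs, funcOfSgn, inner_smul_right]

theorem speed_le_crs_funcOfSgn {x u : DualVec3} (hu : IsDualSgnValue u x) (y z : DualVec3) :
    speed x ≤ crs x (funcOfSgn u y z) := by
  rw [crs_funcOfSgn, speed]
  have hfst : 0 ≤ inner ℝ x.fst u.fst := (norm_nonneg _).trans hu.1.norm_le_inner
  have hsnd : 0 ≤ inner ℝ x.snd u.snd := (norm_nonneg _).trans hu.2.norm_le_inner
  refine add_le_add (hu.1.norm_le_inner.trans (le_mul_of_one_le_left hfst ?_))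
    (hu.2.norm_le_inner.trans (le_mul_of_one_le_left hsnd ?_))
  · exact le_add_of_nonneg_left (by positivity)
  · exact le_add_of_nonneg_left (by positivity)

theorem crs_le_mul_crs_funcOfSgn {x u y z v : DualVec3} {θ : ℝ} (hu : IsDualSgnValue u x)
    (hfst : ‖v.fst‖ ≤ θ * (‖cross y.fst y.snd + z.snd‖ + 1))
    (hsnd : ‖v.snd‖ ≤ θ * (‖y.fst‖ ^ 2 + ‖z.fst‖ + 1)) :
    crs x v ≤ θ * crs x (funcOfSgn u y z) := by
  have key : ∀ {a b c : Vec3} {K : ℝ}, IsSgnValue b a → ‖c‖ ≤ K → inner ℝ a c ≤ K * inner ℝ a b :=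
    fun {a b c K} hb hc => by
      calc inner ℝ a c ≤ ‖a‖ * ‖c‖ := real_inner_le_norm a c
        _ ≤ inner ℝ a b * K :=
          mul_le_mul hb.norm_le_inner hc (norm_nonneg c) ((norm_nonneg a).trans hb.norm_le_inner)
        _ = K * inner ℝ a b := mul_comm _ _
  rw [crs_funcOfSgn, mul_add, ← mul_assoc, ← mul_assoc]
  exact add_le_add (key hu.1 hsnd) (key hu.2 hfst)

/-! ### The dual inertia operator -/

section Inertia

variable {m : ℝ} {J : Matrix (Fin 3) (Fin 3) ℝ}

theorem inertia_add (x y : DualVec3) : inertia m J (x + y) = inertia m J x + inertia m J y := by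
  ext1 <;> simp

theorem inertia_sub (x y : DualVec3) : inertia m J (x - y) = inertia m J x - inertia m J y := by
  ext1 <;> simp [smul_sub]

theorem HasDualDerivWithinAt.inertia {f : ℝ → DualVec3} {f' : DualVec3} {s : Set ℝ} {t : ℝ}
    (hf : HasDualDerivWithinAt f f' s t) :
    HasDualDerivWithinAt (fun τ => inertia m J (f τ)) (inertia m J f') s t := by
  simp only [HasDualDerivWithinAt, fst_inertia, snd_inertia]
  exact ⟨hf.2.const_smul m, (Matrix.toEuclideanCLM (𝕜 := ℝ) J).hasFDerivAt.comp_hasDerivWithinAt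
    t hf.1⟩

theorem inner_toEuclideanCLM_comm (hJ : J.IsHermitian) (x y : Vec3) :
    inner ℝ x (Matrix.toEuclideanCLM (𝕜 := ℝ) J y) =
      inner ℝ (Matrix.toEuclideanCLM (𝕜 := ℝ) J x) y := by
  rw [← ContinuousLinearMap.adjoint_inner_left, ← ContinuousLinearMap.star_eq_adjoint, ← map_star,
    Matrix.star_eq_conjTranspose, hJ.eq]

theorem crs_inertia_comm (hJ : J.IsHermitian) (x y : DualVec3) :
    crs x (inertia m J y) = crs (inertia m J x) y := by
  simp only [crs, fst_inertia, snd_inertia, inner_toEuclideanCLM_comm hJ, real_inner_smul_left,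
    real_inner_smul_right]
  ring

/-- The gyroscopic term does no work on the error except through the desired motion `y`. -/
theorem crs_inertia_dualCross_sub (hJ : J.IsHermitian) (x y : DualVec3) :
    crs x (inertia m J (dualCross x y)) - crs x (dualCross (x + y) (inertia m J (x + y))) =
      -crs x (dualCross y (inertia m J y)) := by
  rw [crs_dualCross_right x (x + y), dualCross_add_self, inertia_add, crs_add_right,
    crs_inertia_comm hJ x, crs_comm (inertia m J x), crs_dualCross_right x y]
  ring

theorem exists_pos_mul_norm_sq_le_inner {E : Type*} [NormedAddCommGroup E]
    [InnerProductSpace ℝ E] [FiniteDimensional ℝ E] (L : E →L[ℝ] E)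
    (hL : ∀ x ≠ 0, 0 < inner ℝ x (L x)) : ∃ c > 0, ∀ x, c * ‖x‖ ^ 2 ≤ inner ℝ x (L x) := by
  rcases subsingleton_or_nontrivial E with hE | hE
  · exact ⟨1, one_pos, fun x => by simp [Subsingleton.elim x 0]⟩
  have hcont : Continuous fun x : E => inner ℝ x (L x) := continuous_id.inner L.continuous
  obtain ⟨x₀, hx₀, hmin⟩ := (isCompact_sphere (0 : E) 1).exists_isMinOn
    (NormedSpace.sphere_nonempty.2 zero_le_one) hcont.continuousOn
  refine ⟨inner ℝ x₀ (L x₀), hL x₀ (ne_zero_of_mem_unit_sphere ⟨x₀, hx₀⟩), fun x => ?_⟩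
  rcases eq_or_ne x 0 with rfl | hx
  · simp
  have hn : ‖x‖ ≠ 0 := norm_ne_zero_iff.2 hx
  have hle : inner ℝ x₀ (L x₀) ≤ inner ℝ (‖x‖⁻¹ • x) (L (‖x‖⁻¹ • x)) :=
    hmin (show ‖x‖⁻¹ • x ∈ Metric.sphere (0 : E) 1 by simp [norm_smul, hn])
  rw [map_smul, real_inner_smul_left, real_inner_smul_right] at hle
  calc inner ℝ x₀ (L x₀) * ‖x‖ ^ 2 ≤ ‖x‖⁻¹ * (‖x‖⁻¹ * inner ℝ x (L x)) * ‖x‖ ^ 2 := by gcongr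
    _ = inner ℝ x (L x) := by field_simp

theorem exists_pos_mul_norm_sq_le_inner_toEuclideanCLM (hJ : J.PosDef) :
    ∃ c > 0, ∀ x : Vec3, c * ‖x‖ ^ 2 ≤ inner ℝ x (Matrix.toEuclideanCLM (𝕜 := ℝ) J x) := by
  refine exists_pos_mul_norm_sq_le_inner _ fun x hx => ?_
  have hpos := hJ.dotProduct_mulVec_pos (x := x.ofLp) (by simpa using hx)
  simpa [PiLp.inner_apply, dotProduct, Matrix.toEuclideanCLM_toLp, mul_comm] using hpos

end Inertia

/-! ### The energy of the tracking error -/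

/-- The Lyapunov function of the tracking error `(D, W)`: kinetic energy of the velocity error,
plus the distance of the pose error from `σ • 1` weighted by the gain `kp`. -/
noncomputable def energy (m : ℝ) (J : Matrix (Fin 3) (Fin 3) ℝ) (kp σ : ℝ) (D : DualQuat)
    (W : DualVec3) : ℝ :=
  1 / 2 * crs W (inertia m J W) + kp * (‖D.snd‖ ^ 2 + ‖D.fst - σ • (1 : ℍ[ℝ])‖ ^ 2)

section Energy

variable {m kp σ : ℝ} {J : Matrix (Fin 3) (Fin 3) ℝ}

theorem crs_inertia_self (x : DualVec3) :
    crs x (inertia m J x) =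
      inner ℝ x.fst (Matrix.toEuclideanCLM (𝕜 := ℝ) J x.fst) + m * ‖x.snd‖ ^ 2 := by
  rw [crs, fst_inertia, snd_inertia, real_inner_smul_right, real_inner_self_eq_norm_sq]

theorem energy_le (hm : 0 ≤ m) (hkp : 0 ≤ kp) {R : ℝ} {D : DualQuat} {W : DualVec3}
    (hfst : ‖D.fst - σ • (1 : ℍ[ℝ])‖ ≤ R) (hsnd : ‖D.snd‖ ≤ R) :
    energy m J kp σ D W ≤
      (m + ‖Matrix.toEuclideanCLM (𝕜 := ℝ) J‖ + 4 * kp) / 2 * (speed W + R) ^ 2 := by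
  have hR : 0 ≤ R := (norm_nonneg _).trans hsnd
  have hWr : ‖W.fst‖ ≤ speed W + R := by unfold speed; linarith [norm_nonneg W.snd]
  have hWc : ‖W.snd‖ ≤ speed W + R := by unfold speed; linarith [norm_nonneg W.fst]
  have hR' : R ≤ speed W + R := le_add_of_nonneg_left (speed_nonneg W)
  have hrot : inner ℝ W.fst (Matrix.toEuclideanCLM (𝕜 := ℝ) J W.fst) ≤
      ‖Matrix.toEuclideanCLM (𝕜 := ℝ) J‖ * (speed W + R) ^ 2 := by
    calc inner ℝ W.fst (Matrix.toEuclideanCLM (𝕜 := ℝ) J W.fst)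
        ≤ ‖W.fst‖ * ‖Matrix.toEuclideanCLM (𝕜 := ℝ) J W.fst‖ := real_inner_le_norm _ _
      _ ≤ ‖W.fst‖ * (‖Matrix.toEuclideanCLM (𝕜 := ℝ) J‖ * ‖W.fst‖) := by
          gcongr; exact ContinuousLinearMap.le_opNorm _ _
      _ = ‖Matrix.toEuclideanCLM (𝕜 := ℝ) J‖ * ‖W.fst‖ ^ 2 := by ring
      _ ≤ ‖Matrix.toEuclideanCLM (𝕜 := ℝ) J‖ * (speed W + R) ^ 2 := by gcongr
  have htrans : m * ‖W.snd‖ ^ 2 ≤ m * (speed W + R) ^ 2 := by gcongr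
  have hpose : kp * (‖D.snd‖ ^ 2 + ‖D.fst - σ • (1 : ℍ[ℝ])‖ ^ 2) ≤
      kp * ((speed W + R) ^ 2 + (speed W + R) ^ 2) := by
    gcongr
    exacts [hsnd.trans hR', hfst.trans hR']
  rw [energy, crs_inertia_self]
  linarith

theorem exists_pos_mul_speed_sq_le_energy (hm : 0 < m) (hkp : 0 ≤ kp) (hJ : J.PosDef) :
    ∃ c > 0, ∀ σ D W, c * speed W ^ 2 ≤ energy m J kp σ D W := by
  obtain ⟨c, hc, hJc⟩ := exists_pos_mul_norm_sq_le_inner_toEuclideanCLM hJ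
  refine ⟨min m c / 4, by positivity, fun σ D W => ?_⟩
  have hrot : min m c * ‖W.fst‖ ^ 2 ≤ inner ℝ W.fst (Matrix.toEuclideanCLM (𝕜 := ℝ) J W.fst) :=
    (mul_le_mul_of_nonneg_right (min_le_right m c) (sq_nonneg _)).trans (hJc W.fst)
  have htrans : min m c * ‖W.snd‖ ^ 2 ≤ m * ‖W.snd‖ ^ 2 := by gcongr; exact min_le_left m c
  have hpose : 0 ≤ kp * (‖D.snd‖ ^ 2 + ‖D.fst - σ • (1 : ℍ[ℝ])‖ ^ 2) := by positivity
  have hspeed : min m c * speed W ^ 2 ≤ min m c * (2 * (‖W.fst‖ ^ 2 + ‖W.snd‖ ^ 2)) := by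
    gcongr
    exact add_sq_le
  rw [energy, crs_inertia_self]
  linarith

theorem exists_speed_le_of_energy_le (hm : 0 < m) (hkp : 0 ≤ kp) (hJ : J.PosDef) :
    ∃ C, 0 ≤ C ∧ ∀ (σ R : ℝ) (D D₀ : DualQuat) (W W₀ : DualVec3),
      energy m J kp σ D W ≤ energy m J kp σ D₀ W₀ →
      ‖D₀.fst - σ • (1 : ℍ[ℝ])‖ ≤ R → ‖D₀.snd‖ ≤ R → speed W ≤ C * (speed W₀ + R) := by
  obtain ⟨c, hc, hlow⟩ := exists_pos_mul_speed_sq_le_energy hm hkp hJ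
  set K := (m + ‖Matrix.toEuclideanCLM (𝕜 := ℝ) J‖ + 4 * kp) / 2
  have hK : 0 ≤ K := by positivity
  refine ⟨√(K / c), Real.sqrt_nonneg _, fun σ R D D₀ W W₀ hE hfst hsnd => ?_⟩
  have hsum : 0 ≤ speed W₀ + R := add_nonneg (speed_nonneg W₀) ((norm_nonneg _).trans hsnd)
  refine le_of_sq_le_sq ?_ (by positivity)
  rw [mul_pow, Real.sq_sqrt (div_nonneg hK hc.le), div_mul_eq_mul_div, le_div_iff₀ hc, mul_comm]
  exact (hlow σ D W).trans (hE.trans (energy_le hm.le hkp hfst hsnd))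

end Energy

/-! ### Decay of the energy -/

/-- The disturbance of the velocity error: `d` together with the inertial forces that tracking the
transported desired velocity `y` with acceleration `z` requires. -/
noncomputable def perturbation (m : ℝ) (J : Matrix (Fin 3) (Fin 3) ℝ) (d y z : DualVec3) :
    DualVec3 :=
  d - (inertia m J z + dualCross y (inertia m J y))

/-- `θ` dominates the mass, the inertia matrix and the disturbance `d`. The margin `2 * kp` absorbs
the attitude feedback, which has the wrong sign when the attitude error is close to `-1`. -/
structure IsUncertaintyBound (m : ℝ) (J : Matrix (Fin 3) (Fin 3) ℝ) (kp θ : ℝ) (d : DualVec3) :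
    Prop where
  mass_le : m ≤ θ
  norm_inertia_le : ‖Matrix.toEuclideanCLM (𝕜 := ℝ) J‖ ≤ θ
  norm_fst_le : ‖d.fst‖ ≤ θ
  norm_snd_add_le : ‖d.snd‖ + 2 * kp ≤ θ

section EnergyRate

variable {m kp kd θ θhat σ : ℝ} {J : Matrix (Fin 3) (Fin 3) ℝ} {D : DualQuat}
  {W u ωd ωd' d w y z f : DualVec3}

theorem norm_fst_perturbation_le (hm : 0 ≤ m) (hmθ : m ≤ θ) (hd : ‖d.fst‖ ≤ θ) :
    ‖(perturbation m J d y z).fst‖ ≤ θ * (‖cross y.fst y.snd + z.snd‖ + 1) := by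
  have hfst : (perturbation m J d y z).fst = d.fst - m • (cross y.fst y.snd + z.snd) := by
    ext i
    fin_cases i <;> simp [perturbation] <;> ring
  calc ‖(perturbation m J d y z).fst‖ ≤ ‖d.fst‖ + ‖m • (cross y.fst y.snd + z.snd)‖ :=
        hfst ▸ norm_sub_le _ _
    _ = ‖d.fst‖ + m * ‖cross y.fst y.snd + z.snd‖ := by rw [norm_smul, Real.norm_of_nonneg hm]
    _ ≤ θ + θ * ‖cross y.fst y.snd + z.snd‖ := by gcongr
    _ = θ * (‖cross y.fst y.snd + z.snd‖ + 1) := by ring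

theorem norm_snd_perturbation_le (hJ : ‖Matrix.toEuclideanCLM (𝕜 := ℝ) J‖ ≤ θ)
    (hd : ‖d.snd‖ ≤ θ) :
    ‖(perturbation m J d y z).snd‖ ≤ θ * (‖y.fst‖ ^ 2 + ‖z.fst‖ + 1) := by
  have hsnd : (perturbation m J d y z).snd = d.snd - (Matrix.toEuclideanCLM (𝕜 := ℝ) J z.fst +
      cross y.fst (Matrix.toEuclideanCLM (𝕜 := ℝ) J y.fst)) := by
    ext i
    fin_cases i <;> simp [perturbation] <;> ring
  have hz := ContinuousLinearMap.le_of_opNorm_le _ hJ z.fst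
  have hy := ContinuousLinearMap.le_of_opNorm_le _ hJ y.fst
  calc ‖(perturbation m J d y z).snd‖
      ≤ ‖d.snd‖ + (‖Matrix.toEuclideanCLM (𝕜 := ℝ) J z.fst‖ +
          ‖y.fst‖ * ‖Matrix.toEuclideanCLM (𝕜 := ℝ) J y.fst‖) :=
        hsnd ▸ norm_sub_le_of_le le_rfl (norm_add_le_of_le le_rfl (norm_cross_le _ _))
    _ ≤ θ + (θ * ‖z.fst‖ + ‖y.fst‖ * (θ * ‖y.fst‖)) := by gcongr
    _ = θ * (‖y.fst‖ ^ 2 + ‖z.fst‖ + 1) := by ring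

theorem crs_inertia_velocityError_deriv (hJ : J.IsHermitian)
    (hw : inertia m J w = -dualCross (W + y) (inertia m J (W + y)) + f + d) :
    crs W (inertia m J (w - (z - dualCross W y))) =
      crs W f + crs W (perturbation m J d y z) := by
  rw [inertia_sub, inertia_sub, hw, perturbation]
  simp only [crs_add_right, crs_sub_right, crs_neg_right]
  linarith [crs_inertia_dualCross_sub (m := m) hJ W y]

theorem crs_control :
    crs W (control kp kd θhat D W u ωd ωd') =
      -(θhat * crs W (funcOfSgn u (tr D ωd) (tr D ωd'))) - kd * (‖W.fst‖ ^ 2 + ‖W.snd‖ ^ 2) -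
        kp * (inner ℝ (red (star D.fst * D.snd)) W.snd + inner ℝ (red D.fst) W.fst) := by
  simp only [control, crs_sub_right, crs_neg_right, crs_smul_right, crs_exch_self]
  simp only [crs, fst_dual, snd_dual, fst_dualConj, inner_zero_right, real_inner_comm W.fst,
    real_inner_comm W.snd]
  ring

/-- The attitude feedback turns up with the factor `σ - 1` after the potential energy is
differentiated; for `σ = -1` it is treated as a part of the disturbance. -/
theorem crs_perturbation_add_le (hm : 0 ≤ m) (hkp : 0 ≤ kp) (hσ : σ = 1 ∨ σ = -1)
    (hD : ‖D.fst‖ = 1) (hθ : IsUncertaintyBound m J kp θ d) (hu : IsDualSgnValue u W) :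
    crs W (perturbation m J d y z) + kp * ((σ - 1) * inner ℝ (red D.fst) W.fst) ≤
      θ * crs W (funcOfSgn u y z) := by
  set e : DualVec3 := dual 0 (((σ - 1) * kp) • red D.fst) with he
  have hσ' : |σ - 1| ≤ 2 := by rcases hσ with rfl | rfl <;> norm_num
  have hfst : ‖(d + e).fst‖ ≤ θ := by simpa [he] using hθ.norm_fst_le
  have hsnd : ‖(d + e).snd‖ ≤ θ := by
    have he_norm : ‖e.snd‖ = |σ - 1| * kp * ‖red D.fst‖ := by
      rw [he, snd_dual, norm_smul, Real.norm_eq_abs, abs_mul, abs_of_nonneg hkp]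
    calc ‖(d + e).snd‖ ≤ ‖d.snd‖ + |σ - 1| * kp * ‖red D.fst‖ := by
          rw [TrivSqZeroExt.snd_add, ← he_norm]
          exact norm_add_le _ _
      _ ≤ ‖d.snd‖ + 2 * kp * 1 := by gcongr; exact (norm_red_le _).trans_eq hD
      _ ≤ θ := by rw [mul_one]; exact hθ.norm_snd_add_le
  have hsum : crs W (perturbation m J d y z) + kp * ((σ - 1) * inner ℝ (red D.fst) W.fst) =
      crs W (perturbation m J (d + e) y z) := by
    have he' : crs W e = kp * ((σ - 1) * inner ℝ (red D.fst) W.fst) := by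
      rw [he, crs, fst_dual, snd_dual, inner_zero_right, real_inner_smul_right, real_inner_comm]
      ring
    rw [perturbation, perturbation, ← he', crs_sub_right, crs_sub_right, crs_add_right W d]
    ring
  rw [hsum]
  exact crs_le_mul_crs_funcOfSgn hu (norm_fst_perturbation_le hm hθ.mass_le hfst)
    (norm_snd_perturbation_le hθ.norm_inertia_le hsnd)

theorem energy_rate_le (hm : 0 ≤ m) (hkp : 0 ≤ kp) (hkd : 0 ≤ kd) (hJ : J.IsHermitian)
    (hσ : σ = 1 ∨ σ = -1) (hD : ‖D.fst‖ = 1) (hθ : IsUncertaintyBound m J kp θ d)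
    (hu : IsDualSgnValue u W)
    (hw : inertia m J w = -dualCross (W + tr D ωd) (inertia m J (W + tr D ωd)) +
      control kp kd θhat D W u ωd ωd' + d) :
    crs W (inertia m J (w - (tr D ωd' - dualCross W (tr D ωd)))) +
        kp * (inner ℝ (red (star D.fst * D.snd)) W.snd + σ * inner ℝ (red D.fst) W.fst) ≤
      (θ - θhat) * crs W (funcOfSgn u (tr D ωd) (tr D ωd')) := by
  have hpert := crs_perturbation_add_le (y := tr D ωd) (z := tr D ωd') hm hkp hσ hD hθ hu
  have hdamp : 0 ≤ kd * (‖W.fst‖ ^ 2 + ‖W.snd‖ ^ 2) := by positivity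
  rw [crs_inertia_velocityError_deriv hJ hw, crs_control]
  linarith

end EnergyRate

section EnergyDerivative

variable {T m kp σ t : ℝ} {J : Matrix (Fin 3) (Fin 3) ℝ} {D : ℝ → DualQuat} {W : ℝ → DualVec3}

theorem Kinematics.hasDerivWithinAt_norm_sq_add (h : Kinematics T D W) (ht : t ∈ Icc 0 T) :
    HasDerivWithinAt (fun τ => ‖(D τ).snd‖ ^ 2 + ‖(D τ).fst - σ • (1 : ℍ[ℝ])‖ ^ 2)
      (inner ℝ (red (star (D t).fst * (D t).snd)) (W t).snd +
        σ * inner ℝ (red (D t).fst) (W t).fst) (Icc 0 T) t := by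
  have hsnd := (h.hasDerivWithinAt_snd ht).norm_sq
  have hfst := ((h.hasDerivWithinAt_fst ht).sub_const (σ • (1 : ℍ[ℝ]))).norm_sq
  refine (hsnd.add hfst).congr_deriv (congrArg₂ (· + ·) ?_ ?_) <;>
  · simp [inner_quaternion_eq, inner_vec3_eq]
    ring

theorem Kinematics.hasDerivWithinAt_energy (hJ : J.IsHermitian) (h : Kinematics T D W)
    (ht : t ∈ Icc 0 T) {W' : DualVec3} (hW : HasDualDerivWithinAt W W' (Icc 0 T) t) :
    HasDerivWithinAt (fun τ => energy m J kp σ (D τ) (W τ))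
      (crs (W t) (inertia m J W') + kp * (inner ℝ (red (star (D t).fst * (D t).snd)) (W t).snd +
        σ * inner ℝ (red (D t).fst) (W t).fst)) (Icc 0 T) t := by
  refine (((hW.crs hW.inertia).const_mul (1 / 2)).add
    ((h.hasDerivWithinAt_norm_sq_add ht).const_mul kp)).congr_deriv ?_
  rw [crs_inertia_comm hJ W', crs_comm (inertia m J W')]
  ring

theorem absolutelyContinuousOnInterval_energy (hD : DualAbsolutelyContinuous D T)
    (hW : DualAbsolutelyContinuous W T) :
    AbsolutelyContinuousOnInterval (fun t => energy m J kp σ (D t) (W t)) 0 T := by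
  have hsmooth : ContDiff ℝ 1 fun p : (ℍ[ℝ] × ℍ[ℝ]) × (Vec3 × Vec3) =>
      energy m J kp σ (dual p.1.1 p.1.2) (dual p.2.1 p.2.2) := by
    simp only [energy, crs, fst_inertia, snd_inertia, fst_dual, snd_dual]
    exact (contDiff_const.mul ((contDiff_snd.fst.inner ℝ
      ((ContinuousLinearMap.contDiff _).comp contDiff_snd.fst)).add
        (contDiff_snd.snd.inner ℝ (contDiff_snd.snd.const_smul m)))).add
      (contDiff_const.mul ((contDiff_fst.snd.norm_sq ℝ).add
        ((contDiff_fst.fst.sub contDiff_const).norm_sq ℝ)))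
  have key := absolutelyContinuousOnInterval_comp_of_contDiff hsmooth
    (absolutelyContinuousOnInterval_prodMk
      (absolutelyContinuousOnInterval_prodMk hD.1 hD.2)
      (absolutelyContinuousOnInterval_prodMk hW.1 hW.2))
  simpa only [energy, crs, fst_inertia, snd_inertia, fst_dual, snd_dual] using key

end EnergyDerivative

/-! ### One iteration of the closed loop -/

/-- The desired velocity `ωd` has derivative `ωd'` on `[0, T]`, and both are bounded by `c`. -/
structure HasBoundedDeriv (T c : ℝ) (ωd ωd' : ℝ → DualVec3) : Prop where
  hasDualDerivWithinAt : ∀ t ∈ Icc 0 T, HasDualDerivWithinAt ωd (ωd' t) (Icc 0 T) t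
  norm_le : ∀ t ∈ Icc 0 T, ‖(ωd t).fst‖ ≤ c ∧ ‖(ωd t).snd‖ ≤ c
  norm_deriv_le : ∀ t ∈ Icc 0 T, ‖(ωd' t).fst‖ ≤ c ∧ ‖(ωd' t).snd‖ ≤ c

/-- One iteration in error coordinates: the pose error `D` and the velocity error `W` of a body
with velocity `ω` that starts at the attitude error `σ` and is driven by the control law with
estimate `θhat` and signs `u` against the disturbance `d`. -/
structure ClosedLoop (T m : ℝ) (J : Matrix (Fin 3) (Fin 3) ℝ) (kp kd σ : ℝ)
    (ωd ωd' : ℝ → DualVec3) (D : ℝ → DualQuat) (W ω u f d : ℝ → DualVec3) (θhat : ℝ → ℝ) :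
    Prop where
  sign : σ = 1 ∨ σ = -1
  isUnitDual : ∀ t ∈ Icc 0 T, IsUnitDual (D t)
  kinematics : Kinematics T D W
  dynamics : Dynamics T m J ω f d
  velocityError_eq : ∀ t, W t = velocityError (D t) (ωd t) (ω t)
  control_eq : ∀ t ∈ Icc 0 T,
    f t = control kp kd (θhat t) (D t) (W t) (u t) (ωd t) (ωd' t)
  isDualSgnValue : ∀ t ∈ Icc 0 T, IsDualSgnValue (u t) (W t)
  pose_zero : D 0 = σ • (1 : DualQuat)
  velocity_zero : W 0 = 0

namespace ClosedLoop

variable {T m kp kd c σ θ α β : ℝ} {J : Matrix (Fin 3) (Fin 3) ℝ} {ωd ωd' : ℝ → DualVec3}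
  {D : ℝ → DualQuat} {W ω u f d : ℝ → DualVec3} {θhat : ℝ → ℝ}

theorem dualAbsolutelyContinuous (hcl : ClosedLoop T m J kp kd σ ωd ωd' D W ω u f d θhat)
    (hT : 0 ≤ T) (hωd : HasBoundedDeriv T c ωd ωd') : DualAbsolutelyContinuous W T := by
  have hkin := hcl.kinematics
  rw [funext hcl.velocityError_eq] at hkin ⊢
  exact hkin.dualAbsolutelyContinuous_velocityError hT hcl.dynamics.1 hωd.hasDualDerivWithinAt
    ⟨c, hωd.norm_deriv_le⟩

theorem continuousOn (hcl : ClosedLoop T m J kp kd σ ωd ωd' D W ω u f d θhat)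
    (hT : 0 ≤ T) (hωd : HasBoundedDeriv T c ωd ωd') : ContinuousOn W (Icc 0 T) :=
  (hcl.dualAbsolutelyContinuous hT hωd).continuousOn hT

theorem ae_hasDerivWithinAt_energy_le
    (hcl : ClosedLoop T m J kp kd σ ωd ωd' D W ω u f d θhat)
    (hωd : HasBoundedDeriv T c ωd ωd') (hm : 0 ≤ m) (hkp : 0 ≤ kp) (hkd : 0 ≤ kd)
    (hJ : J.IsHermitian) (hθ : ∀ t ∈ Icc 0 T, IsUncertaintyBound m J kp θ (d t)) :
    ∀ᵐ t, t ∈ Icc 0 T → ∃ E',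
      HasDerivWithinAt (fun τ => energy m J kp σ (D τ) (W τ)) E' (Icc 0 T) t ∧
        E' ≤ (θ - θhat t) *
          crs (W t) (funcOfSgn (u t) (tr (D t) (ωd t)) (tr (D t) (ωd' t))) := by
  filter_upwards [(ae_restrict_iff' measurableSet_Icc).1 hcl.dynamics.2] with t h ht
  obtain ⟨w, hw, heq⟩ := h ht
  have hω : ω t = W t + tr (D t) (ωd t) := by
    rw [hcl.velocityError_eq t, velocityError, sub_add_cancel]
  have hW : HasDualDerivWithinAt W
      (w - (tr (D t) (ωd' t) - dualCross (W t) (tr (D t) (ωd t)))) (Icc 0 T) t := by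
    have key : HasDualDerivWithinAt (fun τ => velocityError (D τ) (ωd τ) (ω τ)) _ (Icc 0 T) t :=
      hw.sub (hcl.kinematics.hasDualDerivWithinAt_tr ht (hωd.hasDualDerivWithinAt t ht))
    rwa [← funext hcl.velocityError_eq] at key
  rw [hω, hcl.control_eq t ht] at heq
  exact ⟨_, hcl.kinematics.hasDerivWithinAt_energy hJ ht hW, energy_rate_le hm hkp hkd hJ hcl.sign
    (hcl.isUnitDual t ht).norm_fst (hθ t ht) (hcl.isDualSgnValue t ht) heq⟩

theorem energy_le_energy (hcl : ClosedLoop T m J kp kd σ ωd ωd' D W ω u f d θhat)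
    (hωd : HasBoundedDeriv T c ωd ωd') (hm : 0 ≤ m) (hkp : 0 ≤ kp) (hkd : 0 ≤ kd)
    (hJ : J.IsHermitian) (hθ : ∀ t ∈ Icc 0 T, IsUncertaintyBound m J kp θ (d t))
    (hα : 0 ≤ α) (hαβ : α ≤ β) (hβ : β ≤ T) (hθhat : ∀ t ∈ Ioc α β, θ ≤ θhat t) :
    energy m J kp σ (D β) (W β) ≤ energy m J kp σ (D α) (W α) := by
  have hT : 0 ≤ T := hα.trans (hαβ.trans hβ)
  have hAC : AbsolutelyContinuousOnInterval (fun t => energy m J kp σ (D t) (W t)) 0 T :=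
    absolutelyContinuousOnInterval_energy
      (hcl.kinematics.dualAbsolutelyContinuous hT (hcl.continuousOn hT hωd))
      (hcl.dualAbsolutelyContinuous hT hωd)
  refine le_of_ae_hasDerivAt_nonpos hαβ (hAC.mono ?_) ?_
  · rw [uIcc_of_le hαβ, uIcc_of_le hT]
    exact Icc_subset_Icc hα hβ
  filter_upwards [hcl.ae_hasDerivWithinAt_energy_le hωd hm hkp hkd hJ hθ] with t h ht
  obtain ⟨E', hE', hle⟩ := h ⟨hα.trans ht.1.le, ht.2.le.trans hβ⟩
  refine ⟨E', hE'.hasDerivAt (Icc_mem_nhds (hα.trans_lt ht.1) (ht.2.trans_le hβ)), hle.trans ?_⟩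
  refine mul_nonpos_of_nonpos_of_nonneg (sub_nonpos.2 (hθhat t ⟨ht.1, ht.2.le⟩)) ?_
  exact (speed_nonneg _).trans (speed_le_crs_funcOfSgn
    (hcl.isDualSgnValue t ⟨hα.trans ht.1.le, ht.2.le.trans hβ⟩) _ _)

theorem norm_fst_sub_le (hcl : ClosedLoop T m J kp kd σ ωd ωd' D W ω u f d θhat)
    (hωd : HasBoundedDeriv T c ωd ωd') {t : ℝ} (ht : t ∈ Icc 0 T) :
    ‖(D t).fst - σ • (1 : ℍ[ℝ])‖ ≤ ∫ τ in (0)..t, speed (W τ) := by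
  have hfst : (D 0).fst = σ • (1 : ℍ[ℝ]) := by
    rw [hcl.pose_zero, TrivSqZeroExt.fst_smul, TrivSqZeroExt.fst_one]
  rw [← hfst]
  exact hcl.kinematics.norm_fst_sub_le_integral_speed hcl.isUnitDual
    (hcl.continuousOn (ht.1.trans ht.2) hωd) ht

theorem norm_snd_le (hcl : ClosedLoop T m J kp kd σ ωd ωd' D W ω u f d θhat)
    (hωd : HasBoundedDeriv T c ωd ωd') {t : ℝ} (ht : t ∈ Icc 0 T) :
    ‖(D t).snd‖ ≤ ∫ τ in (0)..t, speed (W τ) := by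
  have hsnd : (D 0).snd = 0 := by
    rw [hcl.pose_zero, TrivSqZeroExt.snd_smul, TrivSqZeroExt.snd_one, smul_zero]
  exact hcl.kinematics.norm_snd_le_integral_speed hcl.isUnitDual hsnd
    (hcl.continuousOn (ht.1.trans ht.2) hωd) ht

end ClosedLoop

/-! ### The segment-based projection -/

/-- `0 = h 0 < h 1 < … < h s = T` with at least one segment. -/
structure IsPartition (T : ℝ) (s : ℕ) (h : ℕ → ℝ) : Prop where
  one_le : 1 ≤ s
  start : h 0 = 0
  last : h s = T
  lt : ∀ j < s, h j < h (j + 1)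

namespace IsPartition

variable {T : ℝ} {s : ℕ} {h : ℕ → ℝ}

theorem monotoneOn (H : IsPartition T s h) : MonotoneOn h (Iic s) :=
  (strictMonoOn_Iic_of_lt_succ H.lt).monotoneOn

theorem node_mem (H : IsPartition T s h) {j : ℕ} (hj : j ≤ s) : h j ∈ Icc 0 T := by
  rw [← H.start, ← H.last]
  exact ⟨H.monotoneOn (Nat.zero_le s) hj (Nat.zero_le j), H.monotoneOn hj (le_refl s) hj⟩

theorem nonneg (H : IsPartition T s h) : 0 ≤ T :=
  H.last ▸ (H.node_mem le_rfl).1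

theorem segment_subset (H : IsPartition T s h) {j : ℕ} (hj : j < s) :
    Ioc (h j) (h (j + 1)) ⊆ Icc 0 T := fun _ ht =>
  ⟨(H.node_mem hj.le).1.trans ht.1.le, ht.2.trans (H.node_mem hj).2⟩

theorem segIndex_eq (H : IsPartition T s h) {j : ℕ} (hj : j < s) {t : ℝ}
    (ht : t ∈ Ioc (h j) (h (j + 1))) : segIndex s h t = j + 1 := by
  refine IsLeast.csInf_eq ⟨⟨by lia, hj, ht.2⟩, fun i ⟨_, his, hti⟩ => ?_⟩
  by_contra! hij
  exact (ht.1.trans_le hti).not_ge (H.monotoneOn his hj.le (Nat.lt_succ_iff.1 hij))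

theorem segIndex_zero (H : IsPartition T s h) : segIndex s h 0 = 1 :=
  IsLeast.csInf_eq ⟨⟨le_rfl, H.one_le, (H.node_mem H.one_le).1⟩, fun _ hi => hi.1⟩

end IsPartition

section Projection

variable {T kc B t τ : ℝ} {s j : ℕ} {h : ℕ → ℝ} {x : ℝ → ℝ}

theorem le_proj (t : ℝ) : x t ≤ proj s h kc x t := by
  unfold proj
  split_ifs with hlt
  · exact le_rfl
  · exact not_lt.1 hlt

theorem proj_le_of_segIndex_eq (H : IsPartition T s h) (hkc : 0 ≤ kc) (hj : j < s)
    (hi : segIndex s h t = j + 1) (ht : x t ≤ B) (hB : ∀ τ ∈ Ioc (h j) (h (j + 1)), x τ ≤ B) :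
    proj s h kc x t ≤ B := by
  unfold proj
  split_ifs
  · exact ht
  rw [hi, Nat.add_sub_cancel]
  have hsup := csSup_le ((nonempty_Ioc.2 (H.lt j hj)).image x) (forall_mem_image.2 hB)
  linarith

theorem proj_le (H : IsPartition T s h) (hkc : 0 ≤ kc) (hj : j < s)
    (ht : t ∈ Ioc (h j) (h (j + 1))) (hB : ∀ τ ∈ Ioc (h j) (h (j + 1)), x τ ≤ B) :
    proj s h kc x t ≤ B :=
  proj_le_of_segIndex_eq H hkc hj (H.segIndex_eq hj ht) (hB t ht) hB

theorem sub_le_proj_of_mem (H : IsPartition T s h) (hj : j < s)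
    (ht : t ∈ Ioc (h j) (h (j + 1))) (hτ : τ ∈ Ioc (h j) (h (j + 1)))
    (hB : ∀ τ ∈ Ioc (h j) (h (j + 1)), x τ ≤ B) : x τ - kc ≤ proj s h kc x t := by
  have hsup : x τ ≤ sSup (x '' Ioc (h j) (h (j + 1))) :=
    le_csSup ⟨B, forall_mem_image.2 hB⟩ (mem_image_of_mem x hτ)
  unfold proj
  rw [H.segIndex_eq hj ht, Nat.add_sub_cancel]
  split_ifs <;> linarith

end Projection

/-! ### Convergence of the learning process -/

theorem integral_le_mul_of_le {f : ℝ → ℝ} {t T B : ℝ} (ht : t ∈ Icc 0 T)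
    (hf : ∀ τ ∈ Icc 0 t, 0 ≤ f τ) (hB : ∀ τ ∈ Icc 0 t, f τ ≤ B) :
    ∫ τ in (0)..t, f τ ≤ T * B := by
  have h0 : (0 : ℝ) ∈ Icc 0 t := ⟨le_rfl, ht.1⟩
  have hB0 : 0 ≤ B := (hf 0 h0).trans (hB 0 h0)
  have hnorm : ‖∫ τ in (0)..t, f τ‖ ≤ B * |t - 0| := by
    refine intervalIntegral.norm_integral_le_of_norm_le_const fun τ hτ => ?_
    have hτ' : τ ∈ Icc 0 t := Ioc_subset_Icc_self (uIoc_of_le ht.1 ▸ hτ)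
    rw [Real.norm_of_nonneg (hf τ hτ')]
    exact hB τ hτ'
  calc ∫ τ in (0)..t, f τ ≤ B * |t - 0| := (Real.le_norm_self _).trans hnorm
    _ = B * t := by rw [sub_zero, abs_of_nonneg ht.1]
    _ ≤ T * B := by rw [mul_comm]; gcongr; exact ht.2

theorem sum_range_le_sum_add_of_le {x A y : ℕ → ℝ} {n : ℕ} {Y : ℝ} (hx : ∀ k, 0 ≤ x k)
    (hxA : ∀ k, x k ≤ A k) (hy : ∀ k, 0 ≤ y k) (hxy : ∀ k, n ≤ k → x k ≤ y k)
    (hY : ∀ K, ∑ k ∈ Finset.range K, y k ≤ Y) (K : ℕ) :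
    ∑ k ∈ Finset.range K, x k ≤ ∑ k ∈ Finset.range n, A k + Y := by
  calc ∑ k ∈ Finset.range K, x k ≤ ∑ k ∈ Finset.range (n + K), x k :=
        Finset.sum_le_sum_of_subset_of_nonneg (Finset.range_mono (Nat.le_add_left K n))
          fun i _ _ => hx i
    _ = ∑ k ∈ Finset.range n, x k + ∑ k ∈ Finset.range K, x (n + k) :=
        Finset.sum_range_add _ _ _
    _ ≤ ∑ k ∈ Finset.range n, A k + ∑ k ∈ Finset.range K, y (n + k) := by
        gcongr with i _ i _
        · exact hxA i
        · exact hxy _ (Nat.le_add_right n i)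
    _ ≤ ∑ k ∈ Finset.range n, A k + ∑ k ∈ Finset.range (n + K), y k := by
        rw [Finset.sum_range_add y]
        gcongr
        exact le_add_of_nonneg_left (Finset.sum_nonneg fun i _ => hy i)
    _ ≤ ∑ k ∈ Finset.range n, A k + Y := by gcongr; exact hY _

/-- An abstract learning process over the segments of `[0, T]`: `a k` is the size of the error of
iteration `k` and `kθ * g k` the increment of the estimate `θhat k`. Once the estimate has reached
the level `θ` on a segment, the error there is controlled by the error before the segment. -/
structure LearningProcess (T : ℝ) (s : ℕ) (h : ℕ → ℝ) (kc kθ θ C : ℝ)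
    (a g θhat : ℕ → ℝ → ℝ) : Prop where
  partition : IsPartition T s h
  kc_nonneg : 0 ≤ kc
  kθ_pos : 0 < kθ
  C_nonneg : 0 ≤ C
  continuousOn : ∀ k, ContinuousOn (a k) (Icc 0 T)
  nonneg : ∀ k, ∀ t ∈ Icc 0 T, 0 ≤ a k t
  initial : ∀ k, a k 0 = 0
  error_le : ∀ k, ∀ t ∈ Icc 0 T, a k t ≤ g k t
  increment_le : ∀ k, ∀ t ∈ Icc 0 T, g k t ≤ C * (1 + ∫ τ in (0)..t, a k τ) * a k t
  saturated : ∀ k, ∀ j < s, (∀ t ∈ Ioc (h j) (h (j + 1)), θ ≤ θhat k t) →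
    ∀ t ∈ Ioc (h j) (h (j + 1)), a k t ≤ C * (a k (h j) + ∫ τ in (0)..(h j), a k τ)
  zero : ∀ t ∈ Icc 0 T, θhat 0 t = 0
  succ : ∀ k, ∀ t ∈ Icc 0 T, θhat (k + 1) t = proj s h kc (θhat k) t + kθ * g (k + 1) t

/-- On `S`, the errors `a k` are summable over the iterations and the estimates `θhat k` are
bounded, both uniformly in time. -/
def LearningBounded (a θhat : ℕ → ℝ → ℝ) (S : Set ℝ) : Prop :=
  ∃ B, ∀ t ∈ S, (∀ K, ∑ k ∈ Finset.range K, a k t ≤ B) ∧ ∀ k, θhat k t ≤ B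

theorem LearningBounded.union {a θhat : ℕ → ℝ → ℝ} {S S' : Set ℝ}
    (hS : LearningBounded a θhat S) (hS' : LearningBounded a θhat S') :
    LearningBounded a θhat (S ∪ S') := by
  obtain ⟨B, hB⟩ := hS
  obtain ⟨B', hB'⟩ := hS'
  refine ⟨max B B', fun t ht => ?_⟩
  rcases ht with ht | ht
  · exact ⟨fun K => le_max_of_le_left ((hB t ht).1 K), fun k => le_max_of_le_left ((hB t ht).2 k)⟩
  · exact ⟨fun K => le_max_of_le_right ((hB' t ht).1 K),
      fun k => le_max_of_le_right ((hB' t ht).2 k)⟩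

namespace LearningProcess

variable {T kc kθ θ C t : ℝ} {s j : ℕ} {h : ℕ → ℝ} {a g θhat : ℕ → ℝ → ℝ}

theorem increment_nonneg (P : LearningProcess T s h kc kθ θ C a g θhat) (k : ℕ)
    (ht : t ∈ Icc 0 T) : 0 ≤ g k t :=
  (P.nonneg k t ht).trans (P.error_le k t ht)

theorem nonneg_of_mem_Icc (P : LearningProcess T s h kc kθ θ C a g θhat) (k : ℕ)
    (ht : t ∈ Icc 0 T) : ∀ τ ∈ Icc 0 t, 0 ≤ a k τ :=
  fun τ hτ => P.nonneg k τ ⟨hτ.1, hτ.2.trans ht.2⟩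

theorem intervalIntegrable (P : LearningProcess T s h kc kθ θ C a g θhat) (k : ℕ)
    (ht : t ∈ Icc 0 T) : IntervalIntegrable (a k) volume 0 t := by
  refine ((P.continuousOn k).mono ?_).intervalIntegrable
  rw [uIcc_of_le ht.1]
  exact Icc_subset_Icc_right ht.2

theorem integral_nonneg (P : LearningProcess T s h kc kθ θ C a g θhat) (k : ℕ)
    (ht : t ∈ Icc 0 T) : 0 ≤ ∫ τ in (0)..t, a k τ :=
  intervalIntegral.integral_nonneg ht.1 (P.nonneg_of_mem_Icc k ht)

theorem sum_integral_le (P : LearningProcess T s h kc kθ θ C a g θhat) {B : ℝ}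
    (ht : t ∈ Icc 0 T) (K : ℕ) (hB : ∀ τ ∈ Icc 0 t, ∑ k ∈ Finset.range K, a k τ ≤ B) :
    ∑ k ∈ Finset.range K, ∫ τ in (0)..t, a k τ ≤ T * B := by
  rw [← intervalIntegral.integral_finsetSum fun k _ => P.intervalIntegrable k ht]
  exact integral_le_mul_of_le ht
    (fun τ hτ => Finset.sum_nonneg fun k _ => P.nonneg_of_mem_Icc k ht τ hτ) hB

theorem increment_le_of_error_le (P : LearningProcess T s h kc kθ θ C a g θhat) {A : ℝ}
    (ht : t ∈ Icc 0 T) (k : ℕ) (hA : ∀ τ ∈ Icc 0 t, a k τ ≤ A) :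
    g k t ≤ C * (1 + T * A) * a k t := by
  have hC := P.C_nonneg
  have ha := P.nonneg k t ht
  refine (P.increment_le k t ht).trans ?_
  gcongr
  exact integral_le_mul_of_le ht (P.nonneg_of_mem_Icc k ht) hA

theorem exists_error_le (P : LearningProcess T s h kc kθ θ C a g θhat) (k : ℕ) :
    ∃ A, ∀ t ∈ Icc 0 T, a k t ≤ A := by
  obtain ⟨A, hA⟩ := isCompact_Icc.exists_bound_of_continuousOn (P.continuousOn k)
  exact ⟨A, fun t ht => (Real.le_norm_self _).trans (hA t ht)⟩

theorem error_le_of_sum_le (P : LearningProcess T s h kc kθ θ C a g θhat) {B : ℝ}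
    (ht : t ∈ Icc 0 T) (hB : ∀ K, ∑ k ∈ Finset.range K, a k t ≤ B) (k : ℕ) : a k t ≤ B :=
  (Finset.single_le_sum (f := fun k => a k t) (fun i _ => P.nonneg i t ht)
    (Finset.self_mem_range_succ k)).trans (hB (k + 1))

theorem estimate_add_increment_le (P : LearningProcess T s h kc kθ θ C a g θhat) (k : ℕ)
    (ht : t ∈ Icc 0 T) : θhat k t + kθ * g (k + 1) t ≤ θhat (k + 1) t := by
  rw [P.succ k t ht]
  gcongr
  exact le_proj t

theorem estimate_mono (P : LearningProcess T s h kc kθ θ C a g θhat) (ht : t ∈ Icc 0 T) :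
    Monotone fun k => θhat k t := by
  refine monotone_nat_of_le_succ fun k => ?_
  have hinc := mul_nonneg P.kθ_pos.le (P.increment_nonneg (k + 1) ht)
  linarith [P.estimate_add_increment_le k ht]

theorem estimate_nonneg (P : LearningProcess T s h kc kθ θ C a g θhat) (k : ℕ)
    (ht : t ∈ Icc 0 T) : 0 ≤ θhat k t := by
  rw [← P.zero t ht]
  exact P.estimate_mono ht (Nat.zero_le k)

theorem mul_sum_error_le_estimate (P : LearningProcess T s h kc kθ θ C a g θhat) (K : ℕ)
    (ht : t ∈ Icc 0 T) : kθ * ∑ k ∈ Finset.range K, a (k + 1) t ≤ θhat K t := by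
  induction K with
  | zero => rw [Finset.sum_range_zero, mul_zero, P.zero t ht]
  | succ K ih =>
    rw [Finset.sum_range_succ, mul_add]
    have hinc := mul_le_mul_of_nonneg_left (P.error_le (K + 1) t ht) P.kθ_pos.le
    linarith [P.estimate_add_increment_le K ht]

theorem exists_estimate_le (P : LearningProcess T s h kc kθ θ C a g θhat) (k : ℕ) (hj : j < s) :
    ∃ M, ∀ t ∈ Ioc (h j) (h (j + 1)), θhat k t ≤ M := by
  induction k with
  | zero => exact ⟨0, fun t ht => (P.zero t (P.partition.segment_subset hj ht)).le⟩
  | succ k ih =>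
    obtain ⟨M, hM⟩ := ih
    obtain ⟨A, hA⟩ := P.exists_error_le (k + 1)
    refine ⟨M + kθ * (C * (1 + T * A) * A), fun t ht => ?_⟩
    have hkθ := P.kθ_pos
    have hC := P.C_nonneg
    have htT := P.partition.segment_subset hj ht
    have hT := P.partition.nonneg
    have hA0 : 0 ≤ A := (P.nonneg (k + 1) t htT).trans (hA t htT)
    rw [P.succ k t htT]
    gcongr
    · exact proj_le P.partition P.kc_nonneg hj ht hM
    · refine (P.increment_le_of_error_le htT (k + 1) fun τ hτ =>
        hA τ ⟨hτ.1, hτ.2.trans htT.2⟩).trans ?_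
      gcongr
      exact hA t htT

theorem learningBounded_of_estimate_lt (P : LearningProcess T s h kc kθ θ C a g θhat)
    (hj : j < s) (hlt : ∀ k, ∀ t ∈ Ioc (h j) (h (j + 1)), θhat k t < θ + kc) :
    LearningBounded a θhat (Ioc (h j) (h (j + 1))) := by
  obtain ⟨A, hA⟩ := P.exists_error_le 0
  refine ⟨max ((θ + kc) / kθ + A) (θ + kc), fun t ht => ⟨fun K => le_max_of_le_left ?_,
    fun k => le_max_of_le_right (hlt k t ht).le⟩⟩
  have htT := P.partition.segment_subset hj ht
  calc ∑ k ∈ Finset.range K, a k t ≤ ∑ k ∈ Finset.range (K + 1), a k t :=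
        Finset.sum_le_sum_of_subset_of_nonneg (Finset.range_mono (Nat.le_succ K))
          fun i _ _ => P.nonneg i t htT
    _ = ∑ k ∈ Finset.range K, a (k + 1) t + a 0 t := Finset.sum_range_succ' _ _
    _ ≤ (θ + kc) / kθ + A := by
        refine add_le_add ?_ (hA t htT)
        rw [le_div_iff₀' P.kθ_pos]
        exact (P.mul_sum_error_le_estimate K htT).trans (hlt K t ht).le

/-! The complementary case: the projection carries a level reached at one time of a segment to the
whole segment, so from the next iteration on the estimate dominates `θ` there. -/

theorem le_estimate_of_reached (P : LearningProcess T s h kc kθ θ C a g θhat) (hj : j < s)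
    {k₀ k : ℕ} {t₀ : ℝ} (ht₀ : t₀ ∈ Ioc (h j) (h (j + 1))) (hge : θ + kc ≤ θhat k₀ t₀)
    (hk : k₀ < k) (ht : t ∈ Ioc (h j) (h (j + 1))) : θ ≤ θhat k t := by
  have htT := P.partition.segment_subset hj ht
  obtain ⟨M, hM⟩ := P.exists_estimate_le k₀ hj
  calc θ ≤ θhat k₀ t₀ - kc := le_sub_iff_add_le.2 hge
    _ ≤ proj s h kc (θhat k₀) t := sub_le_proj_of_mem P.partition hj ht ht₀ hM
    _ ≤ θhat (k₀ + 1) t := by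
        rw [P.succ k₀ t htT]
        exact le_add_of_nonneg_right
          (mul_nonneg P.kθ_pos.le (P.increment_nonneg (k₀ + 1) htT))
    _ ≤ θhat k t := P.estimate_mono htT hk

/-- The error that iteration `k` has built up by the time `t`. -/
noncomputable def inheritedError (a : ℕ → ℝ → ℝ) (t : ℝ) (k : ℕ) : ℝ :=
  a k t + ∫ τ in (0)..t, a k τ

theorem inheritedError_nonneg (P : LearningProcess T s h kc kθ θ C a g θhat)
    (ht : t ∈ Icc 0 T) (k : ℕ) : 0 ≤ inheritedError a t k :=
  add_nonneg (P.nonneg k t ht) (P.integral_nonneg k ht)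

theorem sum_inheritedError_le (P : LearningProcess T s h kc kθ θ C a g θhat) {B : ℝ}
    (ht : t ∈ Icc 0 T) (hB : ∀ τ ∈ Icc 0 t, ∀ K, ∑ k ∈ Finset.range K, a k τ ≤ B) (K : ℕ) :
    ∑ k ∈ Finset.range K, inheritedError a t k ≤ (1 + T) * B := by
  simp only [inheritedError]
  rw [Finset.sum_add_distrib, add_mul, one_mul]
  exact add_le_add (hB t ⟨ht.1, le_rfl⟩ K) (P.sum_integral_le ht K fun τ hτ => hB τ hτ K)

theorem exists_sum_error_le_of_le_estimate (P : LearningProcess T s h kc kθ θ C a g θhat)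
    (hj : j < s) {n : ℕ} (hn : ∀ k, n ≤ k → ∀ t ∈ Ioc (h j) (h (j + 1)), θ ≤ θhat k t) {B : ℝ}
    (hB : ∀ t ∈ Icc 0 (h j), ∀ K, ∑ k ∈ Finset.range K, a k t ≤ B) :
    ∃ B', ∀ t ∈ Ioc (h j) (h (j + 1)), ∀ K, ∑ k ∈ Finset.range K, a k t ≤ B' := by
  have hjT := P.partition.node_mem hj.le
  choose A hA using P.exists_error_le
  refine ⟨∑ k ∈ Finset.range n, A k + C * ((1 + T) * B), fun t ht => ?_⟩
  have htT := P.partition.segment_subset hj ht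
  refine sum_range_le_sum_add_of_le (y := fun k => C * inheritedError a (h j) k)
    (fun k => P.nonneg k t htT) (fun k => hA k t htT)
    (fun k => mul_nonneg P.C_nonneg (P.inheritedError_nonneg hjT k))
    (fun k hk => P.saturated k j hj (hn k hk) t ht) fun K => ?_
  rw [← Finset.mul_sum]
  exact mul_le_mul_of_nonneg_left (P.sum_inheritedError_le hjT hB K) P.C_nonneg

theorem estimate_le_of_le_estimate (P : LearningProcess T s h kc kθ θ C a g θhat)
    (hj : j < s) {n : ℕ} (hn : ∀ k, n ≤ k → ∀ t ∈ Ioc (h j) (h (j + 1)), θ ≤ θhat k t)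
    {A M : ℝ} (hA : ∀ k, ∀ t ∈ Icc 0 (h (j + 1)), a k t ≤ A)
    (hM : ∀ t ∈ Ioc (h j) (h (j + 1)), θhat n t ≤ M) {k : ℕ} (hk : n ≤ k) :
    ∀ t ∈ Ioc (h j) (h (j + 1)), θhat k t ≤
      M + kθ * (C * (1 + T * A) * C) * ∑ i ∈ Finset.Ioc n k, inheritedError a (h j) i := by
  induction k, hk using Nat.le_induction with
  | base => simpa using hM
  | succ k hk ih =>
    intro t ht
    have htT := P.partition.segment_subset hj ht
    have hC := P.C_nonneg
    have hkθ := P.kθ_pos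
    have hT := P.partition.nonneg
    have hA0 : 0 ≤ A := (P.nonneg k t htT).trans (hA k t ⟨htT.1, ht.2⟩)
    rw [P.succ k t htT, ← Finset.insert_Ioc_right_eq_Ioc_add_one hk,
      Finset.sum_insert (by simp), mul_add, add_left_comm, add_comm]
    refine add_le_add ?_ (proj_le P.partition P.kc_nonneg hj ht ih)
    calc kθ * g (k + 1) t ≤ kθ * (C * (1 + T * A) * a (k + 1) t) := by
          gcongr
          exact P.increment_le_of_error_le htT _ fun τ hτ => hA _ τ ⟨hτ.1, hτ.2.trans ht.2⟩
      _ ≤ kθ * (C * (1 + T * A) * (C * inheritedError a (h j) (k + 1))) := by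
          gcongr
          exact P.saturated _ j hj (hn _ (hk.trans (Nat.le_succ k))) t ht
      _ = kθ * (C * (1 + T * A) * C) * inheritedError a (h j) (k + 1) := by ring

theorem exists_estimate_le_of_le_estimate (P : LearningProcess T s h kc kθ θ C a g θhat)
    (hj : j < s) {n : ℕ} (hn : ∀ k, n ≤ k → ∀ t ∈ Ioc (h j) (h (j + 1)), θ ≤ θhat k t)
    {B : ℝ} (hB : ∀ t ∈ Icc 0 (h (j + 1)), ∀ K, ∑ k ∈ Finset.range K, a k t ≤ B) :
    ∃ M, ∀ t ∈ Ioc (h j) (h (j + 1)), ∀ k, θhat k t ≤ M := by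
  have hjT := P.partition.node_mem hj.le
  have hjT' := P.partition.node_mem hj
  obtain ⟨M, hM⟩ := P.exists_estimate_le n hj
  refine ⟨M + kθ * (C * (1 + T * B) * C) * ((1 + T) * B), fun t ht k => ?_⟩
  have hC := P.C_nonneg
  have hkθ := P.kθ_pos
  have hT := P.partition.nonneg
  have hB0 : 0 ≤ B := by simpa using hB 0 ⟨le_rfl, hjT'.1⟩ 0
  calc θhat k t ≤ θhat (max n k) t :=
        P.estimate_mono (P.partition.segment_subset hj ht) (le_max_right n k)
    _ ≤ M + kθ * (C * (1 + T * B) * C) *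
          ∑ i ∈ Finset.Ioc n (max n k), inheritedError a (h j) i :=
        P.estimate_le_of_le_estimate hj hn (fun i τ hτ => P.error_le_of_sum_le
          ⟨hτ.1, hτ.2.trans hjT'.2⟩ (hB τ hτ) i) hM (le_max_left n k) t ht
    _ ≤ M + kθ * (C * (1 + T * B) * C) *
          ∑ i ∈ Finset.range (max n k + 1), inheritedError a (h j) i := by
        gcongr with i
        · exact fun i _ _ => P.inheritedError_nonneg hjT i
        · exact fun i hi => Finset.mem_range_succ_iff.2 (Finset.mem_Ioc.1 hi).2
    _ ≤ M + kθ * (C * (1 + T * B) * C) * ((1 + T) * B) := by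
        gcongr
        exact P.sum_inheritedError_le hjT
          (fun τ hτ => hB τ ⟨hτ.1, hτ.2.trans (P.partition.lt j hj).le⟩) _

theorem exists_sum_error_le (P : LearningProcess T s h kc kθ θ C a g θhat) {b : ℝ}
    (hb : LearningBounded a θhat (Ioc 0 b)) :
    ∃ B, ∀ t ∈ Icc 0 b, ∀ K, ∑ k ∈ Finset.range K, a k t ≤ B := by
  obtain ⟨B, hB⟩ := hb
  refine ⟨max 0 B, fun t ht K => ?_⟩
  rcases ht.1.eq_or_lt with rfl | hpos
  · simp [P.initial]
  · exact le_max_of_le_right ((hB t ⟨hpos, ht.2⟩).1 K)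

theorem learningBounded_segment (P : LearningProcess T s h kc kθ θ C a g θhat) (hj : j < s)
    (hb : LearningBounded a θhat (Ioc 0 (h j))) :
    LearningBounded a θhat (Ioc (h j) (h (j + 1))) := by
  by_cases hlt : ∀ k, ∀ t ∈ Ioc (h j) (h (j + 1)), θhat k t < θ + kc
  · exact P.learningBounded_of_estimate_lt hj hlt
  push Not at hlt
  obtain ⟨k₀, t₀, ht₀, hge⟩ := hlt
  have hn : ∀ k, k₀ + 1 ≤ k → ∀ t ∈ Ioc (h j) (h (j + 1)), θ ≤ θhat k t :=
    fun k hk t ht => P.le_estimate_of_reached hj ht₀ hge hk ht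
  obtain ⟨B, hB⟩ := P.exists_sum_error_le hb
  obtain ⟨B', hB'⟩ := P.exists_sum_error_le_of_le_estimate hj hn hB
  have hmax : ∀ t ∈ Icc 0 (h (j + 1)), ∀ K, ∑ k ∈ Finset.range K, a k t ≤ max B B' := by
    intro t ht K
    rcases le_or_gt t (h j) with hle | hgt
    · exact le_max_of_le_left (hB t ⟨ht.1, hle⟩ K)
    · exact le_max_of_le_right (hB' t ⟨hgt, ht.2⟩ K)
  obtain ⟨M, hM⟩ := P.exists_estimate_le_of_le_estimate hj hn hmax
  exact ⟨max B' M, fun t ht => ⟨fun K => le_max_of_le_left (hB' t ht K),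
    fun k => le_max_of_le_right (hM t ht k)⟩⟩

theorem learningBounded_Ioc (P : LearningProcess T s h kc kθ θ C a g θhat) (hj : j ≤ s) :
    LearningBounded a θhat (Ioc 0 (h j)) := by
  induction j with
  | zero => exact ⟨0, by simp [P.partition.start]⟩
  | succ j ih =>
    rw [← Ioc_union_Ioc_eq_Ioc (P.partition.node_mem (Nat.le_of_lt hj)).1 (P.partition.lt j hj).le]
    exact (ih (Nat.le_of_lt hj)).union (P.learningBounded_segment hj (ih (Nat.le_of_lt hj)))

/-- The time `0` lies in no segment, but the projection treats it as a part of the first one. -/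
theorem estimate_zero_le (P : LearningProcess T s h kc kθ θ C a g θhat) {B : ℝ} (hB0 : 0 ≤ B)
    (hB : ∀ t ∈ Ioc (h 0) (h 1), ∀ k, θhat k t ≤ B) (k : ℕ) : θhat k 0 ≤ B := by
  have h0T : (0 : ℝ) ∈ Icc 0 T := ⟨le_rfl, P.partition.nonneg⟩
  induction k with
  | zero => exact (P.zero 0 h0T).trans_le hB0
  | succ k ih =>
    have hg : g (k + 1) 0 ≤ 0 := by simpa [P.initial] using P.increment_le (k + 1) 0 h0T
    have hproj : proj s h kc (θhat k) 0 ≤ B :=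
      proj_le_of_segIndex_eq P.partition P.kc_nonneg P.partition.one_le P.partition.segIndex_zero
        ih fun τ hτ => hB τ hτ k
    rw [P.succ k 0 h0T]
    linarith [mul_nonpos_of_nonneg_of_nonpos P.kθ_pos.le hg]

theorem exists_bound (P : LearningProcess T s h kc kθ θ C a g θhat) :
    ∃ B, 0 ≤ B ∧ ∀ t ∈ Icc 0 T,
      (∀ K, ∑ k ∈ Finset.range K, a k t ≤ B) ∧ ∀ k, |θhat k t| ≤ B := by
  have hb : LearningBounded a θhat (Ioc 0 T) :=
    P.partition.last ▸ P.learningBounded_Ioc le_rfl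
  obtain ⟨B, hB⟩ := P.exists_sum_error_le hb
  obtain ⟨M, hM⟩ := hb
  have hmax : 0 ≤ max B M := le_max_of_le_left <| by
    simpa using hB 0 ⟨le_rfl, P.partition.nonneg⟩ 0
  refine ⟨max B M, hmax, fun t ht => ⟨fun K => le_max_of_le_left (hB t ht K), fun k => ?_⟩⟩
  rw [abs_of_nonneg (P.estimate_nonneg k ht)]
  rcases ht.1.eq_or_lt with rfl | hpos
  · refine P.estimate_zero_le hmax (fun τ hτ i => le_max_of_le_right ((hM τ ⟨?_, ?_⟩).2 i)) k
    · simpa only [P.partition.start] using hτ.1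
    · exact (P.partition.segment_subset P.partition.one_le hτ).2
  · exact le_max_of_le_right ((hM t ⟨hpos, ht.2⟩).2 k)

theorem tendsto_integral (P : LearningProcess T s h kc kθ θ C a g θhat) (ht : t ∈ Icc 0 T) :
    Tendsto (fun k => ∫ τ in (0)..t, a k τ) atTop (𝓝 0) := by
  obtain ⟨B, -, hB⟩ := P.exists_bound
  refine (summable_of_sum_range_le (c := T * B) (fun k => P.integral_nonneg k ht)
    fun K => ?_).tendsto_atTop_zero
  exact P.sum_integral_le ht K fun τ hτ => (hB τ ⟨hτ.1, hτ.2.trans ht.2⟩).1 K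

end LearningProcess

/-! ### Bounds on the learning gain and on the input -/

theorem norm_neg_smul_sub_smul_sub_smul_le {E : Type*} [SeminormedAddCommGroup E]
    [NormedSpace ℝ E] (a b c : ℝ) (x y z : E) :
    ‖-(a • x) - b • y - c • z‖ ≤ |a| * ‖x‖ + |b| * ‖y‖ + |c| * ‖z‖ := by
  simp only [← Real.norm_eq_abs, ← norm_smul]
  rw [← norm_neg (a • x)]
  exact norm_sub_le_of_le (norm_sub_le _ _) le_rfl

section Gains

variable {D : DualQuat} {W u ωd ωd' : DualVec3} {c R : ℝ}

theorem gain_fst_le (hD : IsUnitDual D) (hDR : ‖D.snd‖ ≤ R) (hωd : ‖ωd.fst‖ ≤ c)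
    (hωd' : ‖ωd'.fst‖ ≤ c) :
    ‖(tr D ωd).fst‖ ^ 2 + ‖(tr D ωd').fst‖ + 1 ≤ (2 * c ^ 2 + 2 * c + 1) * (1 + R) := by
  have hc : 0 ≤ c := (norm_nonneg _).trans hωd
  have hR : 0 ≤ R := (norm_nonneg _).trans hDR
  rw [hD.norm_fst_tr, hD.norm_fst_tr]
  calc ‖ωd.fst‖ ^ 2 + ‖ωd'.fst‖ + 1 ≤ c ^ 2 + c + 1 := by gcongr
    _ ≤ (2 * c ^ 2 + 2 * c + 1) * 1 := by nlinarith
    _ ≤ (2 * c ^ 2 + 2 * c + 1) * (1 + R) := by gcongr; linarith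

theorem gain_snd_le (hD : IsUnitDual D) (hDR : ‖D.snd‖ ≤ R)
    (hωd : ‖ωd.fst‖ ≤ c ∧ ‖ωd.snd‖ ≤ c) (hωd' : ‖ωd'.fst‖ ≤ c ∧ ‖ωd'.snd‖ ≤ c) :
    ‖cross (tr D ωd).fst (tr D ωd).snd + (tr D ωd').snd‖ + 1 ≤
      (2 * c ^ 2 + 2 * c + 1) * (1 + R) := by
  have hc : 0 ≤ c := (norm_nonneg _).trans hωd.1
  have hR : 0 ≤ R := (norm_nonneg _).trans hDR
  have htr : ∀ x : DualVec3, ‖x.fst‖ ≤ c ∧ ‖x.snd‖ ≤ c → ‖(tr D x).snd‖ ≤ c + 2 * R * c := by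
    intro x hx
    refine (hD.norm_snd_tr_le x).trans ?_
    gcongr
    exacts [hx.2, hx.1]
  calc ‖cross (tr D ωd).fst (tr D ωd).snd + (tr D ωd').snd‖ + 1
      ≤ ‖(tr D ωd).fst‖ * ‖(tr D ωd).snd‖ + ‖(tr D ωd').snd‖ + 1 := by
        gcongr
        exact norm_add_le_of_le (norm_cross_le _ _) le_rfl
    _ ≤ c * (c + 2 * R * c) + (c + 2 * R * c) + 1 := by
        rw [hD.norm_fst_tr]
        gcongr
        exacts [hωd.1, htr ωd hωd, htr ωd' hωd']
    _ ≤ (2 * c ^ 2 + 2 * c + 1) * (1 + R) := by nlinarith [sq_nonneg c]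

theorem crs_funcOfSgn_le (hu : IsDualSgnValue u W) (hD : IsUnitDual D) (hDR : ‖D.snd‖ ≤ R)
    (hωd : ‖ωd.fst‖ ≤ c ∧ ‖ωd.snd‖ ≤ c) (hωd' : ‖ωd'.fst‖ ≤ c ∧ ‖ωd'.snd‖ ≤ c) :
    crs W (funcOfSgn u (tr D ωd) (tr D ωd')) ≤
      3 * (2 * c ^ 2 + 2 * c + 1) * (1 + R) * speed W := by
  set G := (2 * c ^ 2 + 2 * c + 1) * (1 + R)
  have hfst : ‖(tr D ωd).fst‖ ^ 2 + ‖(tr D ωd').fst‖ + 1 ≤ G :=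
    gain_fst_le hD hDR hωd.1 hωd'.1
  have hsnd : ‖cross (tr D ωd).fst (tr D ωd).snd + (tr D ωd').snd‖ + 1 ≤ G :=
    gain_snd_le hD hDR hωd hωd'
  have hG : 0 ≤ G := le_trans (by positivity) hfst
  rw [crs_funcOfSgn, speed]
  have hfst' := mul_le_mul hfst hu.1.inner_le ((norm_nonneg _).trans hu.1.norm_le_inner) hG
  have hsnd' := mul_le_mul hsnd hu.2.inner_le ((norm_nonneg _).trans hu.2.norm_le_inner) hG
  linarith

theorem fst_control (kp kd θhat : ℝ) :
    (control kp kd θhat D W u ωd ωd').fst =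
      -(θhat • (‖cross (tr D ωd).fst (tr D ωd).snd + (tr D ωd').snd‖ + 1) • u.snd) -
        kd • W.snd - kp • red (star D.fst * D.snd) := by
  simp [control, funcOfSgn, exch]

theorem snd_control (kp kd θhat : ℝ) :
    (control kp kd θhat D W u ωd ωd').snd =
      -(θhat • (‖(tr D ωd).fst‖ ^ 2 + ‖(tr D ωd').fst‖ + 1) • u.fst) -
        kd • W.fst - kp • red D.fst := by
  simp [control, funcOfSgn, exch]

theorem norm_control_le {kp kd θhat B : ℝ} (hkp : 0 ≤ kp) (hkd : 0 ≤ kd)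
    (hu : IsDualSgnValue u W) (hD : IsUnitDual D) (hDR : ‖D.snd‖ ≤ R)
    (hωd : ‖ωd.fst‖ ≤ c ∧ ‖ωd.snd‖ ≤ c) (hωd' : ‖ωd'.fst‖ ≤ c ∧ ‖ωd'.snd‖ ≤ c)
    (hθhat : |θhat| ≤ B) (hW : speed W ≤ B) :
    ‖(control kp kd θhat D W u ωd ωd').fst‖ ≤
        B * ((2 * c ^ 2 + 2 * c + 1) * (1 + R) * 3) + kd * B + kp * (1 + R) ∧
      ‖(control kp kd θhat D W u ωd ωd').snd‖ ≤
        B * ((2 * c ^ 2 + 2 * c + 1) * (1 + R) * 3) + kd * B + kp * (1 + R) := by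
  have hB : 0 ≤ B := (abs_nonneg _).trans hθhat
  have hR : 0 ≤ R := (norm_nonneg _).trans hDR
  have hc : 0 ≤ c := (norm_nonneg _).trans hωd.1
  have hfst : ‖W.fst‖ ≤ B := (le_add_of_nonneg_right (norm_nonneg _)).trans hW
  have hsnd : ‖W.snd‖ ≤ B := (le_add_of_nonneg_left (norm_nonneg _)).trans hW
  have hred : ‖red D.fst‖ ≤ 1 + R := by
    linarith [norm_red_le D.fst, hD.norm_fst]
  have hred' : ‖red (star D.fst * D.snd)‖ ≤ 1 + R := by
    have h := norm_red_le (star D.fst * D.snd)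
    rw [norm_mul, Quaternion.norm_star, hD.norm_fst] at h
    linarith
  rw [fst_control, snd_control]
  constructor <;> refine (norm_neg_smul_sub_smul_sub_smul_le _ _ _ _ _ _).trans ?_ <;>
    rw [abs_of_nonneg hkd, abs_of_nonneg hkp, norm_smul, Real.norm_of_nonneg (by positivity)] <;>
    gcongr
  exacts [gain_snd_le hD hDR hωd hωd', hu.2.norm_le, gain_fst_le hD hDR hωd.1 hωd'.1, hu.1.norm_le]

end Gains

/-! ### Convergence of poses -/

theorem norm_positionError {Qd Q : ℍ[ℝ]} (hQd : Qd * star Qd = 1) (hQ : Q * star Q = 1)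
    (Pd P : Vec3) :
    ‖positionError Qd Pd Q P‖ = 2 * ‖(poseError (pose Qd Pd) (pose Q P)).snd‖ := by
  have hunit := (isUnitDual_pose hQd Pd).poseError (isUnitDual_pose hQ P)
  set r := star Qd * Q with hr
  have hfst : (poseError (pose Qd Pd) (pose Q P)).fst = r := by simp [poseError, pose, hr]
  have hpure : aug (red (star r * aug Pd * r)) = star r * aug Pd * r :=
    aug_red_of_star_eq_neg (by simp [mul_assoc])
  have hcancel : r * (star r * aug Pd * r) = aug Pd * r := by
    rw [mul_assoc (star r), ← mul_assoc r, ← hfst, hunit.fst_mul_star_fst, one_mul]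
  have hsnd : (poseError (pose Qd Pd) (pose Q P)).snd =
      (1 / 2 : ℝ) • (r * aug (positionError Qd Pd Q P)) := by
    rw [positionError, ← hr, aug_sub, hpure, mul_sub, hcancel]
    simp [poseError, pose, hr, smul_sub, mul_assoc]
    abel
  rw [hsnd, norm_smul, norm_mul, norm_aug, ← hfst, hunit.norm_fst,
    Real.norm_of_nonneg one_half_pos.le]
  ring

theorem norm_smul_of_eq_one_or_neg_one {E : Type*} [SeminormedAddCommGroup E] [NormedSpace ℝ E]
    {c : ℝ} (hc : c = 1 ∨ c = -1) (x : E) : ‖c • x‖ = ‖x‖ := by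
  rcases hc with rfl | rfl <;> simp

section Limits

variable {X : ℕ → DualQuat} {σ : ℕ → ℝ}

theorem tendsto_smul_one (hσ : ∀ k, σ k = 1 ∨ σ k = -1)
    (hfst : Tendsto (fun k => ‖(X k).fst - σ k • (1 : ℍ[ℝ])‖) atTop (𝓝 0))
    (hsnd : Tendsto (fun k => ‖(X k).snd‖) atTop (𝓝 0)) :
    Tendsto (fun k => σ k • X k) atTop (𝓝 1) := by
  have hfst' : Tendsto (fun k => (σ k • X k).fst) atTop (𝓝 (1 : DualQuat).fst) := by
    refine tendsto_iff_norm_sub_tendsto_zero.2 (hfst.congr fun k => ?_)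
    have hsq : σ k * σ k = 1 := by rcases hσ k with hk | hk <;> rw [hk] <;> norm_num
    rw [← norm_smul_of_eq_one_or_neg_one (hσ k), smul_sub, smul_smul, hsq, one_smul,
      TrivSqZeroExt.fst_smul, TrivSqZeroExt.fst_one]
  have hsnd' : Tendsto (fun k => (σ k • X k).snd) atTop (𝓝 (1 : DualQuat).snd) := by
    rw [TrivSqZeroExt.snd_one]
    refine tendsto_zero_iff_norm_tendsto_zero.2 (hsnd.congr fun k => ?_)
    rw [TrivSqZeroExt.snd_smul, norm_smul_of_eq_one_or_neg_one (hσ k)]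
  rw [TrivSqZeroExt.nhds_def]
  exact hfst'.prodMk hsnd'

theorem tendsto_smul_of_tendsto_smul_poseError {Xd : DualQuat} (hXd : IsUnitDual Xd)
    (hX : Tendsto (fun k => σ k • poseError Xd (X k)) atTop (𝓝 1)) :
    Tendsto (fun k => σ k • X k) atTop (𝓝 Xd) := by
  have hmul := hX.const_mul Xd
  simp only [mul_smul_comm, poseError, ← mul_assoc, hXd.2, one_mul, mul_one] at hmul
  exact hmul

theorem tendsto_norm_snd_of_tendsto_smul_one (hσ : ∀ k, σ k = 1 ∨ σ k = -1)
    (hX : Tendsto (fun k => σ k • X k) atTop (𝓝 1)) :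
    Tendsto (fun k => ‖(X k).snd‖) atTop (𝓝 0) := by
  have hsnd := ((TrivSqZeroExt.continuous_snd.tendsto _).comp hX).norm
  simpa [Function.comp_def, norm_smul_of_eq_one_or_neg_one (hσ _)] using hsnd

theorem tendsto_norm_red_fst_of_tendsto_smul_one (hσ : ∀ k, σ k = 1 ∨ σ k = -1)
    (hX : Tendsto (fun k => σ k • X k) atTop (𝓝 1)) :
    Tendsto (fun k => ‖red (X k).fst‖) atTop (𝓝 0) := by
  have hone : redCLM (1 : ℍ[ℝ]) = 0 := by
    ext i; fin_cases i <;> simp [redCLM]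
  have hred := (((redCLM.continuous.comp TrivSqZeroExt.continuous_fst).tendsto _).comp hX).norm
  rw [Function.comp_apply, TrivSqZeroExt.fst_one, hone, norm_zero] at hred
  refine hred.congr fun k => ?_
  rw [Function.comp_apply, Function.comp_apply, TrivSqZeroExt.fst_smul, map_smul,
    norm_smul_of_eq_one_or_neg_one (hσ k)]
  rfl

end Limits

/-! ### Learning over the iterations -/

theorem exists_hasBoundedDeriv {T : ℝ} {ωd ωd' : ℝ → DualVec3}
    (hωd : ∀ t ∈ Icc 0 T, HasDualDerivWithinAt ωd (ωd' t) (Icc 0 T) t)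
    (hωd' : ∃ C, ∀ t ∈ Icc 0 T, ‖(ωd' t).fst‖ ≤ C ∧ ‖(ωd' t).snd‖ ≤ C) :
    ∃ c, HasBoundedDeriv T c ωd ωd' := by
  obtain ⟨c₁, hc₁⟩ :=
    exists_norm_le_of_continuousOn isCompact_Icc (continuousOn_of_hasDualDerivWithinAt hωd)
  obtain ⟨c₂, hc₂⟩ := hωd'
  exact ⟨max c₁ c₂, hωd,
    fun t ht => (hc₁ t ht).imp (le_max_of_le_left ·) (le_max_of_le_left ·),
    fun t ht => (hc₂ t ht).imp (le_max_of_le_right ·) (le_max_of_le_right ·)⟩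

theorem exists_isUncertaintyBound {ι : Type*} {S : Set ℝ} {m βm βJ : ℝ} (kp : ℝ)
    {J : Matrix (Fin 3) (Fin 3) ℝ} {d : ι → ℝ → DualVec3} {βd βs : ℝ → ℝ} (hβm : m ≤ βm)
    (hβJ : ‖Matrix.toEuclideanCLM (𝕜 := ℝ) J‖ ≤ βJ)
    (hβd : ∀ k, ∀ t ∈ S, ‖(d k t).fst‖ ≤ βd t) (hβs : ∀ k, ∀ t ∈ S, ‖(d k t).snd‖ ≤ βs t)
    (hβd_bdd : BddAbove (βd '' S)) (hβs_bdd : BddAbove (βs '' S)) :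
    ∃ θ, ∀ k, ∀ t ∈ S, IsUncertaintyBound m J kp θ (d k t) := by
  obtain ⟨b₁, hb₁⟩ := hβd_bdd
  obtain ⟨b₂, hb₂⟩ := hβs_bdd
  refine ⟨max (max βm βJ) (max b₁ (b₂ + 2 * kp)), fun k t ht => ?_⟩
  have hfst : ‖(d k t).fst‖ ≤ b₁ := (hβd k t ht).trans (hb₁ (mem_image_of_mem βd ht))
  have hsnd : ‖(d k t).snd‖ ≤ b₂ := (hβs k t ht).trans (hb₂ (mem_image_of_mem βs ht))
  exact ⟨le_max_of_le_left (le_max_of_le_left hβm), le_max_of_le_left (le_max_of_le_right hβJ),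
    le_max_of_le_right (le_max_of_le_left hfst),
    le_max_of_le_right (le_max_of_le_right (by gcongr))⟩

section LearningControl

variable {T m kp kd kc kθ c θ C : ℝ} {s : ℕ} {h : ℕ → ℝ} {J : Matrix (Fin 3) (Fin 3) ℝ}
  {ωd ωd' : ℝ → DualVec3}

theorem exists_speed_le_of_le_estimate (hm : 0 < m) (hkp : 0 ≤ kp) (hkd : 0 ≤ kd)
    (hJ : J.PosDef) (hωd : HasBoundedDeriv T c ωd ωd') :
    ∃ C, 0 ≤ C ∧ ∀ {σ α β : ℝ} {D : ℝ → DualQuat} {W ω u f d : ℝ → DualVec3} {θhat : ℝ → ℝ},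
      ClosedLoop T m J kp kd σ ωd ωd' D W ω u f d θhat →
      (∀ t ∈ Icc 0 T, IsUncertaintyBound m J kp θ (d t)) →
      0 ≤ α → α ≤ β → β ≤ T → (∀ t ∈ Ioc α β, θ ≤ θhat t) →
      speed (W β) ≤ C * (speed (W α) + ∫ τ in (0)..α, speed (W τ)) := by
  obtain ⟨C, hC0, hC⟩ := exists_speed_le_of_energy_le hm hkp hJ
  refine ⟨C, hC0, fun {σ α β D W ω u f d θhat} hcl hθ hα hαβ hβ hθhat => ?_⟩
  have hαT : α ∈ Icc 0 T := ⟨hα, hαβ.trans hβ⟩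
  exact hC σ _ (D β) (D α) (W β) (W α)
    (hcl.energy_le_energy hωd hm.le hkp hkd hJ.isHermitian hθ hα hαβ hβ hθhat)
    (hcl.norm_fst_sub_le hωd hαT) (hcl.norm_snd_le hωd hαT)

variable {σ : ℕ → ℝ} {D : ℕ → ℝ → DualQuat} {W ω u f d : ℕ → ℝ → DualVec3} {θhat : ℕ → ℝ → ℝ}

theorem exists_learningProcess (H : IsPartition T s h) (hkp : 0 ≤ kp) (hkd : 0 ≤ kd)
    (hkc : 0 ≤ kc) (hkθ : 0 < kθ) (hm : 0 < m) (hJ : J.PosDef)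
    (hωd : HasBoundedDeriv T c ωd ωd')
    (hθ : ∀ k, ∀ t ∈ Icc 0 T, IsUncertaintyBound m J kp θ (d k t))
    (hcl : ∀ k, ClosedLoop T m J kp kd (σ k) ωd ωd' (D k) (W k) (ω k) (u k) (f k) (d k) (θhat k))
    (hzero : ∀ t ∈ Icc 0 T, θhat 0 t = 0)
    (hsucc : ∀ k, ∀ t ∈ Icc 0 T, θhat (k + 1) t - proj s h kc (θhat k) t =
      learningIncrement kθ (D (k + 1) t) (W (k + 1) t) (ωd t) (ωd' t)) :
    ∃ C, LearningProcess T s h kc kθ θ C (fun k t => speed (W k t))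
      (fun k t => crs (W k t) (func (W k t) (tr (D k t) (ωd t)) (tr (D k t) (ωd' t)))) θhat := by
  obtain ⟨C, hC0, hC⟩ := exists_speed_le_of_le_estimate (θ := θ) hm hkp hkd hJ hωd
  have hint : ∀ k t, 0 ≤ t → 0 ≤ ∫ τ in (0)..t, speed (W k τ) := fun k _ ht =>
    intervalIntegral.integral_nonneg ht fun τ _ => speed_nonneg (W k τ)
  refine ⟨max C (3 * (2 * c ^ 2 + 2 * c + 1)), ?_⟩
  exact
    { partition := H
      kc_nonneg := hkc
      kθ_pos := hkθ
      C_nonneg := le_max_of_le_left hC0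
      continuousOn := fun k =>
        continuous_speed.comp_continuousOn ((hcl k).continuousOn H.nonneg hωd)
      nonneg := fun k t _ => speed_nonneg (W k t)
      initial := fun k => by simp [(hcl k).velocity_zero, speed]
      error_le := fun k t _ => speed_le_crs_funcOfSgn (isDualSgnValue_dualSgn _) _ _
      increment_le := fun k t ht => by
        refine (crs_funcOfSgn_le (isDualSgnValue_dualSgn _) ((hcl k).isUnitDual t ht)
          ((hcl k).norm_snd_le hωd ht) (hωd.norm_le t ht) (hωd.norm_deriv_le t ht)).trans ?_
        have := speed_nonneg (W k t)
        have := hint k t ht.1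
        gcongr
        exact le_max_right _ _
      saturated := fun k j hj hsat t ht => by
        have hjT := H.node_mem hj.le
        have htT := H.segment_subset hj ht
        refine (hC (hcl k) (hθ k) hjT.1 ht.1.le htT.2 fun τ hτ =>
          hsat τ ⟨hτ.1, hτ.2.trans ht.2⟩).trans ?_
        have := speed_nonneg (W k (h j))
        have := hint k (h j) hjT.1
        gcongr
        exact le_max_left _ _
      zero := hzero
      succ := fun k t ht => sub_eq_iff_eq_add'.1 (hsucc k t ht) }

theorem tendsto_smul_poseError {g : ℕ → ℝ → ℝ} {t : ℝ} (hωd : HasBoundedDeriv T c ωd ωd')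
    (hcl : ∀ k, ClosedLoop T m J kp kd (σ k) ωd ωd' (D k) (W k) (ω k) (u k) (f k) (d k) (θhat k))
    (P : LearningProcess T s h kc kθ θ C (fun k t => speed (W k t)) g θhat) (ht : t ∈ Icc 0 T) :
    Tendsto (fun k => σ k • D k t) atTop (𝓝 1) :=
  tendsto_smul_one (fun k => (hcl k).sign)
    (squeeze_zero (fun _ => norm_nonneg _) (fun k => (hcl k).norm_fst_sub_le hωd ht)
      (P.tendsto_integral ht))
    (squeeze_zero (fun _ => norm_nonneg _) (fun k => (hcl k).norm_snd_le hωd ht)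
      (P.tendsto_integral ht))

theorem exists_norm_le {g : ℕ → ℝ → ℝ} (hkp : 0 ≤ kp) (hkd : 0 ≤ kd)
    (hωd : HasBoundedDeriv T c ωd ωd')
    (hcl : ∀ k, ClosedLoop T m J kp kd (σ k) ωd ωd' (D k) (W k) (ω k) (u k) (f k) (d k) (θhat k))
    (P : LearningProcess T s h kc kθ θ C (fun k t => speed (W k t)) g θhat) :
    ∃ B : ℝ, ∀ k, ∀ t ∈ Icc 0 T, ‖(f k t).fst‖ ≤ B ∧ ‖(f k t).snd‖ ≤ B ∧
      ‖(D k t).fst‖ ≤ B ∧ ‖(D k t).snd‖ ≤ B ∧ ‖(W k t).fst‖ ≤ B ∧ ‖(W k t).snd‖ ≤ B ∧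
      |θhat k t| ≤ B := by
  obtain ⟨B, hB0, hB⟩ := P.exists_bound
  have hspeed : ∀ k, ∀ t ∈ Icc 0 T, speed (W k t) ≤ B := fun k t ht =>
    P.error_le_of_sum_le ht (hB t ht).1 k
  have hsnd : ∀ k, ∀ t ∈ Icc 0 T, ‖(D k t).snd‖ ≤ T * B := fun k t ht =>
    ((hcl k).norm_snd_le hωd ht).trans <|
      integral_le_mul_of_le ht (fun τ _ => speed_nonneg (W k τ)) fun τ hτ =>
        hspeed k τ ⟨hτ.1, hτ.2.trans ht.2⟩
  have hTB : 0 ≤ T * B := mul_nonneg P.partition.nonneg hB0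
  have hf : ∀ k, ∀ t ∈ Icc 0 T, _ := fun k t ht =>
    (hcl k).control_eq t ht ▸ norm_control_le hkp hkd ((hcl k).isDualSgnValue t ht)
      ((hcl k).isUnitDual t ht) (hsnd k t ht) (hωd.norm_le t ht) (hωd.norm_deriv_le t ht)
      ((hB t ht).2 k) (hspeed k t ht)
  set F := B * ((2 * c ^ 2 + 2 * c + 1) * (1 + T * B) * 3) + kd * B + kp * (1 + T * B)
  refine ⟨max F (1 + T * B + B), fun k t ht => ?_⟩
  have hunit := ((hcl k).isUnitDual t ht).norm_fst
  have hW : ‖(W k t).fst‖ + ‖(W k t).snd‖ ≤ B := hspeed k t ht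
  have hfst := norm_nonneg (W k t).fst
  have hsnd' := norm_nonneg (W k t).snd
  refine ⟨le_max_of_le_left (hf k t ht).1, le_max_of_le_left (hf k t ht).2, ?_⟩
  refine ⟨?_, ?_, ?_, ?_, ?_⟩ <;> refine le_max_of_le_right ?_
  · linarith
  · linarith [hsnd k t ht]
  · linarith
  · linarith
  · linarith [(hB t ht).2 k]

end LearningControl

end DualILC

theorem theorem1
    -- time horizon and its segments
    (T : ℝ) (s : ℕ) (hs : 1 ≤ s) (h : ℕ → ℝ) (h_zero : h 0 = 0) (h_last : h s = T)
    (h_lt : ∀ j < s, h j < h (j + 1))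
    -- control and learning parameters
    (kp kd kc kθ : ℝ) (hkp : 0 < kp) (hkd : 0 < kd) (hkc : 0 < kc) (hkθ : 0 < kθ)
    -- mass and inertia matrix of the body
    (m : ℝ) (hm : 0 < m) (J : Matrix (Fin 3) (Fin 3) ℝ) (hJ : J.PosDef)
    -- desired motion
    (Qd : ℝ → Quaternion ℝ) (Pd : ℝ → Vec3) (ωd ωd' : ℝ → DualVec3)
    (hQd : ∀ t ∈ Set.Icc 0 T, Qd t * star (Qd t) = 1)
    (hd_kin : Kinematics T (fun t => pose (Qd t) (Pd t)) ωd)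
    (hωd : ∀ t ∈ Set.Icc 0 T, HasDualDerivWithinAt ωd (ωd' t) (Set.Icc 0 T) t)
    (hωd' : ∃ C : ℝ, ∀ t ∈ Set.Icc 0 T, ‖(ωd' t).fst‖ ≤ C ∧ ‖(ωd' t).snd‖ ≤ C)
    -- motion, input, disturbance and estimate in iteration `k`
    (Q : ℕ → ℝ → Quaternion ℝ) (P : ℕ → ℝ → Vec3) (ω f d : ℕ → ℝ → DualVec3)
    (θhat : ℕ → ℝ → ℝ)
    (hQ : ∀ k, ∀ t ∈ Set.Icc 0 T, Q k t * star (Q k t) = 1)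
    (h_kin : ∀ k, Kinematics T (fun t => pose (Q k t) (P k t)) (ω k))
    (h_dyn : ∀ k, Dynamics T m J (ω k) (f k) (d k))
    -- tracking errors
    (δQ : ℕ → ℝ → DualQuat) (δω : ℕ → ℝ → DualVec3)
    (hδQ : ∀ k t, δQ k t = poseError (pose (Qd t) (Pd t)) (pose (Q k t) (P k t)))
    (hδω : ∀ k t, δω k t = velocityError (δQ k t) (ωd t) (ω k t))
    -- initial conditions
    (sg : ℕ → ℝ) (hsg : ∀ k, sg k = 1 ∨ sg k = -1)
    (hδQ_zero : ∀ k, δQ k 0 = sg k • (1 : DualQuat))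
    (hδω_zero : ∀ k, δω k 0 = 0)
    -- bounds on parameters and disturbances
    (βm βJ : ℝ) (βd βs : ℝ → ℝ) (hβm : m ≤ βm)
    (hβJ : ‖Matrix.toEuclideanCLM (𝕜 := ℝ) J‖ ≤ βJ)
    (hβd : ∀ k, ∀ t ∈ Set.Icc 0 T, ‖(d k t).fst‖ ≤ βd t)
    (hβs : ∀ k, ∀ t ∈ Set.Icc 0 T, ‖(d k t).snd‖ ≤ βs t)
    (hβd_bdd : BddAbove (βd '' Set.Icc 0 T)) (hβs_bdd : BddAbove (βs '' Set.Icc 0 T))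
    -- control law; `u k t` is the value taken for the sign of `δω k t`
    (u : ℕ → ℝ → DualVec3)
    (hu : ∀ k, ∀ t ∈ Set.Icc 0 T, IsDualSgnValue (u k t) (δω k t))
    (hf : ∀ k, ∀ t ∈ Set.Icc 0 T,
      f k t = control kp kd (θhat k t) (δQ k t) (δω k t) (u k t) (ωd t) (ωd' t))
    -- learning law
    (hθ_zero : ∀ t ∈ Set.Icc 0 T, θhat 0 t = 0)
    (hθ_succ : ∀ k, ∀ t ∈ Set.Icc 0 T,
      θhat (k + 1) t - proj s h kc (θhat k) t =
        learningIncrement kθ (δQ (k + 1) t) (δω (k + 1) t) (ωd t) (ωd' t)) :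
    -- perfect tracking at every time
    (∀ t ∈ Set.Icc 0 T,
      Filter.Tendsto (fun k => sg k • δQ k t) Filter.atTop (nhds 1) ∧
      Filter.Tendsto (fun k => sg k • pose (Q k t) (P k t)) Filter.atTop
        (nhds (pose (Qd t) (Pd t))) ∧
      Filter.Tendsto (fun k => ‖positionError (Qd t) (Pd t) (Q k t) (P k t)‖)
        Filter.atTop (nhds 0) ∧
      Filter.Tendsto (fun k => ‖red (δQ k t).fst‖) Filter.atTop (nhds 0)) ∧
    -- boundedness, uniform in the time and in the iteration
    (∃ B : ℝ, ∀ k, ∀ t ∈ Set.Icc 0 T,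
      ‖(f k t).fst‖ ≤ B ∧ ‖(f k t).snd‖ ≤ B ∧
      ‖(δQ k t).fst‖ ≤ B ∧ ‖(δQ k t).snd‖ ≤ B ∧
      ‖(δω k t).fst‖ ≤ B ∧ ‖(δω k t).snd‖ ≤ B ∧
      |θhat k t| ≤ B) := by
  obtain rfl : δQ = fun k t => poseError (pose (Qd t) (Pd t)) (pose (Q k t) (P k t)) := funext₂ hδQ
  have hXd : ∀ t ∈ Icc 0 T, IsUnitDual (pose (Qd t) (Pd t)) := fun t ht =>
    isUnitDual_pose (hQd t ht) (Pd t)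
  have hX : ∀ k, ∀ t ∈ Icc 0 T, IsUnitDual (pose (Q k t) (P k t)) := fun k t ht =>
    isUnitDual_pose (hQ k t ht) (P k t)
  obtain ⟨c, hc⟩ := exists_hasBoundedDeriv hωd hωd'
  obtain ⟨θ, hθ⟩ := exists_isUncertaintyBound kp hβm hβJ hβd hβs hβd_bdd hβs_bdd
  have hcl (k : ℕ) : ClosedLoop T m J kp kd (sg k) ωd ωd' _ (δω k) (ω k) (u k) (f k) (d k)
      (θhat k) :=
    { sign := hsg k
      isUnitDual := fun t ht => (hXd t ht).poseError (hX k t ht)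
      kinematics := funext (hδω k) ▸ hd_kin.poseError (h_kin k) hXd (hX k)
      dynamics := h_dyn k
      velocityError_eq := hδω k
      control_eq := hf k
      isDualSgnValue := hu k
      pose_zero := hδQ_zero k
      velocity_zero := hδω_zero k }
  obtain ⟨C, hP⟩ := exists_learningProcess ⟨hs, h_zero, h_last, h_lt⟩ hkp.le hkd.le hkc.le hkθ hm
    hJ hc hθ hcl hθ_zero hθ_succ
  refine ⟨fun t ht => ?_, exists_norm_le hkp.le hkd.le hc hcl hP⟩
  have hlim := tendsto_smul_poseError hc hcl hP ht
  refine ⟨hlim, tendsto_smul_of_tendsto_smul_poseError (hXd t ht) hlim, ?_,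
    tendsto_norm_red_fst_of_tendsto_smul_one hsg hlim⟩
  simp only [norm_positionError (hQd t ht) (hQ _ t ht)]
  simpa only [mul_zero] using (tendsto_norm_snd_of_tendsto_smul_one hsg hlim).const_mul 2
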